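/- **Setting.** Consider for $j=1,\dots,\ell$ the lower-triangular system $$\dot z_j=q_j(\hat z_j,\hat x_j,w),\qquad \dot x_j=f_j(\hat z_j,\hat x_j,w)+b_jx_{j+1},$$ with $z_j\in\mathbb R^{n_j}$, $x_j\in\mathbb R$, $\hat z_j=\mathrm{col}(z_1,\dots,z_j)$, $\hat x_j=\mathrm{col}(x_1,\dots,x_j)$, constants $b_j\neq0$, input $u=x_{\ell+1}$, and an unknown constant parameter $w$ in a compact set $\mathbb W$. The functions $q_j,f_j$ are continuously differentiable and vanish at $(0,0,w)$ for all $w\in\mathbb W$. All norms are Euclidean, $\|d_{[t_0,t]}\|=\sup_{s\in[t_0,t]}\|d(s)\|$, and inputs are piecewise continuous and bounded; an estimate for a system is meant along all its solutions, on every interval on which they exist, with the same comparison functions for all $w\in\mathbb W$. A function $\gamma$ is said to have *finite slope at zero* if $\lim_{s\to0^+}\gamma(s)/s$ exists and is finite. **Assumption.** For each $j$ the $z_j$-subsystem is ISS with inputs $\hat z_{j-1},\hat x_j$: there are $\beta_{z_j}\in\mathcal{KL}$ and $\gamma_{z_j}^z,\gamma_{z_j}^x\in\mathcal K_\infty$ of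 finite slope at zero such that $$\|z_j(t)\|\le\max\{\beta_{z_j}(\|z_j(t_0)\|,t-t_0),\ \gamma_{z_j}^z(\|\hat z_{j-1[t_0,t]}\|),\ \gamma_{z_j}^x(\|\hat x_{j[t_0,t]}\|)\},\qquad t\ge t_0 .$$ **Design.** Put $\bar x_1=x_1$, $\bar x_{j+1}=x_{j+1}-\vartheta_j(\bar x_j)$, $\hat{\bar x}_j=\mathrm{col}(\bar x_1,\dots,\bar x_j)$, with $$\vartheta_j(\bar x_j)=-\bigl(\bar c_j+\tfrac14b_j^2+m_j(\bar x_j)+\psi_j(|\bar x_j|)\bigr)\bar x_j/b_j,\qquad \bar c_1=c_1,\quad \bar c_j=2c_j\ (j\ge2),\quad c_j>0,$$ and write the $\bar x_j$-equation as $\dot{\bar x}_j=\bar f_j(\hat z_j,\hat{\bar x}_j,w)+b_j\vartheta_j(\bar x_j)+b_j\bar x_{j+1}$. Here $\iota_j,\tilde m_j,m_j$ are nonnegative continuously differentiable functions such that, for all $w\in\mathbb W$, $$|\bar f_j(\hat z_j,\hat{\bar x}_j,w)|\le\iota_j(\|\hat z_j\|)\|\hat z_j\|+\tilde m_j(\|\hat{\bar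 x}_{j-1}\|)\|\hat{\bar x}_{j-1}\|+m_j(\bar x_j)|\bar x_j|$$ (without the $\tilde m_j$ term if $j=1$); put $\bar\iota_j(s)=\iota_j^2(s)s^2/(4c_j)$ and $\bar m_j(s)=\tilde m_j^2(s)s^2/(4c_j)$. The functions $\psi_j$ are continuously differentiable and even, $\rho_j(s)=\psi_j(s)s^2$ is of class $\mathcal K$ on $[0,\infty)$, and for all $s>0$ $$\psi_1(s)>k_1\max\{\bar\iota_1\circ\gamma_{z_1}^x(s)/s^2,\,1\},\qquad \psi_j(s)>k_j\max\{\bar m_j(s)/s^2,\ \bar\iota_j\circ\gamma_{Z_j}^{X_j}(2s)/s^2,\ 2\}\quad(j\ge2),$$ where $k_1>2$, $k_j>3$ for $j\ge2$. The gains are defined recursively by $$\bar\gamma_{Z_1}^{x_2}(s)=\gamma_{z_1}^x\bigl(\rho_1^{-1}(k_1s^2)\bigr),\quad \gamma_{Z_j}^{X_j}=2\max\{\bar\gamma_{z_j}^x,\ \bar\gamma_{Z_{j-1}}^{x_j},\ \gamma_{z_j}^z\circ\bar\gamma_{Z_{j-1}}^{x_j}\},\quad \bar\gamma_{Z_j}^{x_{j+1}}(s)=\gamma_{Z_j}^{X_j}\bigl(2\rho_j^{-1}(k_js^2)\bigr)\quad(j\ge2),$$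 where, for $j\ge2$, $\bar\gamma_{z_j}^x\in\mathcal K_\infty$ is a function of finite slope at zero that can replace $\gamma_{z_j}^x$ in the ISS estimate of the $z_j$-subsystem (with some $\beta\in\mathcal{KL}$) when the input $\hat x_j$ is measured as $\hat{\bar x}_j$, i.e. when $\gamma_{z_j}^x(\|\hat x_{j[t_0,t]}\|)$ is replaced by $\bar\gamma_{z_j}^x(\|\hat{\bar x}_{j[t_0,t]}\|)$. **Lemma.** Under the assumption, functions $\bar\gamma_{z_j}^x$ of this kind exist. For every choice of them and every design as above, the following holds for each $j=1,\dots,\ell$. The $(\hat z_j,\hat{\bar x}_j)$-dynamics with arbitrary external input $\bar x_{j+1}$ are ISS in the sense that, for all $t\ge t_0$, $$\|\hat z_j(t)\|\le\max\{\bar\beta_{Z_j}(\|\mathrm{col}(\hat z_j(t_0),\hat{\bar x}_j(t_0))\|,t-t_0),\ \bar\gamma_{Z_j}^{x_{j+1}}(\|\bar x_{j+1[t_0,t]}\|)\},$$ $$\|\hat{\bar x}_j(t)\|\le\max\{\bar\beta_{X_j}(\|\mathrm{col}(\hat z_j(t_0),\hat{\bar x}_j(t_0))\|,t-t_0),\ \bar\gamma_{X_j}^{x_{j+1}}(\|\bar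 x_{j+1[t_0,t]}\|)\}$$ for some $\bar\beta_{Z_j},\bar\beta_{X_j}\in\mathcal{KL}$ and some $\bar\gamma_{X_j}^{x_{j+1}}\in\mathcal K$, where $\bar\gamma_{Z_j}^{x_{j+1}}\in\mathcal K$ is the function defined above; moreover $\bar\gamma_{X_j}^{x_{j+1}}(s)<s$ for all $s>0$, and $\lim_{s\to0^+}\bar\gamma_{Z_j}^{x_{j+1}}(s)/s$ exists and is finite. -/

import Mathlib

open Set Filter Topology

/-! ### Comparison functions -/

/-- Class `K`: continuous, strictly increasing on `[0, ∞)`, zero at zero. -/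
def IsClassK (α : ℝ → ℝ) : Prop :=
  ContinuousOn α (Ici 0) ∧ StrictMonoOn α (Ici 0) ∧ α 0 = 0

/-- Class `K∞`: class `K` and unbounded. -/
def IsClassKInf (α : ℝ → ℝ) : Prop :=
  IsClassK α ∧ Tendsto α atTop atTop

/-- Class `KL`: `β (·, t)` is of class `K` for each `t ≥ 0`, and `β (s, ·)` is nonincreasing on
`[0, ∞)` with limit zero for each `s ≥ 0`. -/
def IsClassKL (β : ℝ → ℝ → ℝ) : Prop :=
  (∀ t, 0 ≤ t → IsClassK (fun s => β s t)) ∧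
    ∀ s, 0 ≤ s → AntitoneOn (β s) (Ici 0) ∧ Tendsto (β s) atTop (𝓝 0)

/-- `lim_{s → 0+} γ s / s` exists and is finite. -/
def HasFiniteSlopeAtZero (γ : ℝ → ℝ) : Prop :=
  ∃ L : ℝ, Tendsto (fun s => γ s / s) (𝓝[>] 0) (𝓝 L)

/-! ### Signals -/

/-- `‖d_{[t₀, t]}‖`, the supremum of `‖d s‖` over `s ∈ [t₀, t]` (used for bounded signals). -/
noncomputable def supNorm {E : Type*} [NormedAddCommGroup E] (d : ℝ → E) (t₀ t : ℝ) : ℝ :=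
  sSup ((fun s => ‖d s‖) '' Icc t₀ t)

/-- `d` is bounded on `[t₀, T]` and continuous there up to finitely many points. -/
def IsPiecewiseContBdd {E : Type*} [NormedAddCommGroup E] (d : ℝ → E) (t₀ T : ℝ) : Prop :=
  (∃ S : Set ℝ, S.Finite ∧ ContinuousOn d (Icc t₀ T \ S)) ∧
    ∃ M : ℝ, ∀ t ∈ Icc t₀ T, ‖d t‖ ≤ M

/-- `y` is a solution of `ẏ(t) = v(t)` on `[t₀, T]`: it is continuous, and the equation holds at
all interior times up to finitely many. -/
def IsSolution {E : Type*} [NormedAddCommGroup E] [NormedSpace ℝ E] (y v : ℝ → E)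
    (t₀ T : ℝ) : Prop :=
  ContinuousOn y (Icc t₀ T) ∧
    ∃ S : Set ℝ, S.Finite ∧ ∀ t ∈ Ioo t₀ T \ S, HasDerivAt y (v t) t

/-! ### Stacked vectors

Stages are numbered `0, 1, …, ℓ - 1`.  The stack of the first `k` blocks carries the Euclidean
norm. -/

/-- The space of `col(z_0, …, z_{k-1})` with `z_i ∈ ℝ^{n i}`. -/
abbrev ZVec (n : ℕ → ℕ) (k : ℕ) : Type :=
  PiLp 2 (fun i : Fin k => EuclideanSpace ℝ (Fin (n i)))

/-- The space of `col(x_0, …, x_{k-1})` with `x_i ∈ ℝ`. -/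
abbrev XVec (k : ℕ) : Type := EuclideanSpace ℝ (Fin k)

/-- `col(z_0, …, z_{k-1})`. -/
def zHead {n : ℕ → ℕ} (k : ℕ) (z : ∀ i : ℕ, EuclideanSpace ℝ (Fin (n i))) : ZVec n k :=
  WithLp.toLp 2 (fun i : Fin k => z i)

/-- `col(x_0, …, x_{k-1})`. -/
def xHead (k : ℕ) (x : ℕ → ℝ) : XVec k :=
  WithLp.toLp 2 (fun i : Fin k => x i)

/-! ### The plant -/

/-- The lower-triangular system with dynamic uncertainties
`ż_j = q_j (ẑ_j, x̂_j, w)`, `ẋ_j = f_j (ẑ_j, x̂_j, w) + b_j x_{j+1}`, `j = 0, …, ℓ - 1`,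
with `ẑ_j = col(z_0, …, z_j)`, `x̂_j = col(x_0, …, x_j)`, constant uncertain parameter `w` in the
compact set `W`, and control input `u = x_ℓ`. Data with index `j ≥ ℓ` play no role. -/
structure LTSystem where
  ℓ : ℕ
  n : ℕ → ℕ
  p : ℕ
  W : Set (EuclideanSpace ℝ (Fin p))
  q : ∀ j : ℕ, ZVec n (j + 1) → XVec (j + 1) → EuclideanSpace ℝ (Fin p) →
    EuclideanSpace ℝ (Fin (n j))
  f : ∀ j : ℕ, ZVec n (j + 1) → XVec (j + 1) → EuclideanSpace ℝ (Fin p) → ℝ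
  b : ℕ → ℝ
  isCompact_W : IsCompact W
  contDiff_q : ∀ j, j < ℓ → ContDiff ℝ 1
    (fun v : ZVec n (j + 1) × XVec (j + 1) × EuclideanSpace ℝ (Fin p) => q j v.1 v.2.1 v.2.2)
  contDiff_f : ∀ j, j < ℓ → ContDiff ℝ 1
    (fun v : ZVec n (j + 1) × XVec (j + 1) × EuclideanSpace ℝ (Fin p) => f j v.1 v.2.1 v.2.2)
  q_zero : ∀ j, j < ℓ → ∀ w ∈ W, q j 0 0 w = 0
  f_zero : ∀ j, j < ℓ → ∀ w ∈ W, f j 0 0 w = 0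
  b_ne_zero : ∀ j, j < ℓ → b j ≠ 0

/-- A value of the stacked state `(z_0, z_1, …)`. -/
abbrev LTSystem.ZState (P : LTSystem) : Type := ∀ i : ℕ, EuclideanSpace ℝ (Fin (P.n i))

/-- The `z_j`-equation on `[t₀, T]`. -/
def LTSystem.SolvesZ (P : LTSystem) (w : EuclideanSpace ℝ (Fin P.p)) (j : ℕ)
    (z : ℝ → P.ZState) (x : ℝ → ℕ → ℝ) (t₀ T : ℝ) : Prop :=
  IsSolution (fun t => z t j)
    (fun t => P.q j (zHead (j + 1) (z t)) (xHead (j + 1) (x t)) w) t₀ T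

/-- The `x_j`-equation on `[t₀, T]`. -/
def LTSystem.SolvesX (P : LTSystem) (w : EuclideanSpace ℝ (Fin P.p)) (j : ℕ)
    (z : ℝ → P.ZState) (x : ℝ → ℕ → ℝ) (t₀ T : ℝ) : Prop :=
  IsSolution (fun t => x t j)
    (fun t => P.f j (zHead (j + 1) (z t)) (xHead (j + 1) (x t)) w + P.b j * x t (j + 1)) t₀ T

/-- The `z_j`-subsystem is ISS for all `w ∈ W`, with state `z_j`, inputs `ẑ_{j-1}` and `x̂_j`, and
gains `γz`, `γx`. The inputs are arbitrary piecewise continuous bounded signals; the estimate is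
required on every interval on which the solution exists, so there is no finite escape. -/
def LTSystem.ZSubsystemISS (P : LTSystem) (j : ℕ) (γz γx : ℝ → ℝ) : Prop :=
  ∃ β : ℝ → ℝ → ℝ, IsClassKL β ∧
    ∀ w ∈ P.W, ∀ t₀ T : ℝ, t₀ ≤ T → ∀ (z : ℝ → P.ZState) (x : ℝ → ℕ → ℝ),
      IsPiecewiseContBdd (fun t => zHead j (z t)) t₀ T →
      IsPiecewiseContBdd (fun t => xHead (j + 1) (x t)) t₀ T →
      P.SolvesZ w j z x t₀ T →
      ∀ t ∈ Icc t₀ T, ‖z t j‖ ≤ max (β ‖z t₀ j‖ (t - t₀))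
        (max (γz (supNorm (fun s => zHead j (z s)) t₀ t))
          (γx (supNorm (fun s => xHead (j + 1) (x s)) t₀ t)))

/-! ### The change of coordinates -/

/-- `x̄_0 = x_0`, `x̄_{j+1} = x_{j+1} - ϑ_j (x̄_j)`. -/
def xBar (θ : ℕ → ℝ → ℝ) (x : ℕ → ℝ) : ℕ → ℝ
  | 0 => x 0
  | j + 1 => x (j + 1) - θ j (xBar θ x j)

/-- The inverse transformation `x_0 = x̄_0`, `x_{j+1} = x̄_{j+1} + ϑ_j (x̄_j)`. -/
def xOrig (θ : ℕ → ℝ → ℝ) (y : ℕ → ℝ) : ℕ → ℝ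
  | 0 => y 0
  | j + 1 => y (j + 1) + θ j (y j)

/-- `f̄_j (ẑ_j, x̄̂_j, w)`: the drift of the `x̄_j`-equation
`x̄_j' = f̄_j + b_j ϑ_j (x̄_j) + b_j x̄_{j+1}`. It depends only on the first `j + 1` entries of `z`
and `y`. -/
noncomputable def LTSystem.fBar (P : LTSystem) (θ : ℕ → ℝ → ℝ) :
    ℕ → P.ZState → (ℕ → ℝ) → EuclideanSpace ℝ (Fin P.p) → ℝ
  | 0, z, y, w => P.f 0 (zHead 1 z) (xHead 1 (xOrig θ y)) w
  | j + 1, z, y, w =>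
      P.f (j + 1) (zHead (j + 2) z) (xHead (j + 2) (xOrig θ y)) w
        - deriv (θ j) (y j) *
          (P.fBar θ j z y w + P.b j * θ j (y j) + P.b j * y (j + 1))

/-- The same as `ZSubsystemISS`, with the input `x̂_j` measured in the new coordinates `x̄̂_j`. -/
def LTSystem.ZSubsystemISSBar (P : LTSystem) (θ : ℕ → ℝ → ℝ) (j : ℕ) (γz γx : ℝ → ℝ) : Prop :=
  ∃ β : ℝ → ℝ → ℝ, IsClassKL β ∧
    ∀ w ∈ P.W, ∀ t₀ T : ℝ, t₀ ≤ T → ∀ (z : ℝ → P.ZState) (x : ℝ → ℕ → ℝ),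
      IsPiecewiseContBdd (fun t => zHead j (z t)) t₀ T →
      IsPiecewiseContBdd (fun t => xHead (j + 1) (xBar θ (x t))) t₀ T →
      P.SolvesZ w j z x t₀ T →
      ∀ t ∈ Icc t₀ T, ‖z t j‖ ≤ max (β ‖z t₀ j‖ (t - t₀))
        (max (γz (supNorm (fun s => zHead j (z s)) t₀ t))
          (γx (supNorm (fun s => xHead (j + 1) (xBar θ (x s))) t₀ t)))

/-- The `(ẑ_j, x̄̂_j)`-dynamics, with external input `x̄_{j+1}`, are ISS with gain `gZ` to `ẑ_j` and
gain `gX` to `x̄̂_j`, uniformly in `w ∈ W`. -/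
def LTSystem.StageISS (P : LTSystem) (θ : ℕ → ℝ → ℝ) (j : ℕ) (gZ gX : ℝ → ℝ) : Prop :=
  ∃ βZ βX : ℝ → ℝ → ℝ, IsClassKL βZ ∧ IsClassKL βX ∧
    ∀ w ∈ P.W, ∀ t₀ T : ℝ, t₀ ≤ T → ∀ (z : ℝ → P.ZState) (x : ℝ → ℕ → ℝ),
      IsPiecewiseContBdd (fun t => xBar θ (x t) (j + 1)) t₀ T →
      (∀ i, i ≤ j → P.SolvesZ w i z x t₀ T ∧ P.SolvesX w i z x t₀ T) →
      ∀ t ∈ Icc t₀ T,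
        ‖zHead (j + 1) (z t)‖ ≤
          max (βZ ‖WithLp.toLp 2 (zHead (j + 1) (z t₀), xHead (j + 1) (xBar θ (x t₀)))‖ (t - t₀))
            (gZ (supNorm (fun s => xBar θ (x s) (j + 1)) t₀ t)) ∧
        ‖xHead (j + 1) (xBar θ (x t))‖ ≤
          max (βX ‖WithLp.toLp 2 (zHead (j + 1) (z t₀), xHead (j + 1) (xBar θ (x t₀)))‖ (t - t₀))
            (gX (supNorm (fun s => xBar θ (x s) (j + 1)) t₀ t))

/-! ### The recursive design -/

/-- The functions and constants selected in the design: `γzz j`, `γzx j` are the ISS gains of the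
`z_j`-subsystem from `ẑ_{j-1}` and `x̂_j`; `ι`, `mt` (for `m̃`) and `m` bound the drift; `c`, `k`
and `ψ` are the controller parameters. -/
structure Design where
  γzz : ℕ → ℝ → ℝ
  γzx : ℕ → ℝ → ℝ
  ι : ℕ → ℝ → ℝ
  mt : ℕ → ℝ → ℝ
  m : ℕ → ℝ → ℝ
  c : ℕ → ℝ
  k : ℕ → ℝ
  ψ : ℕ → ℝ → ℝ

namespace Design

/-- `c̄_0 = c_0` and `c̄_j = 2 c_j` for `j ≥ 1`. -/
def cBar (D : Design) : ℕ → ℝ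
  | 0 => D.c 0
  | j + 1 => 2 * D.c (j + 1)

/-- `ῑ_j (s) = ι_j(s)² s² / (4 c_j)`. -/
noncomputable def ιBar (D : Design) (j : ℕ) (s : ℝ) : ℝ :=
  1 / (4 * D.c j) * D.ι j s ^ 2 * s ^ 2

/-- `m̄_j (s) = m̃_j(s)² s² / (4 c_j)`. -/
noncomputable def mBar (D : Design) (j : ℕ) (s : ℝ) : ℝ :=
  1 / (4 * D.c j) * D.mt j s ^ 2 * s ^ 2

/-- The virtual controllers
`ϑ_j (x) = -(c̄_j + b_j² / 4 + m_j (x) + ψ_j (|x|)) x / b_j`. -/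
noncomputable def θ (D : Design) (b : ℕ → ℝ) (j : ℕ) (x : ℝ) : ℝ :=
  -(D.cBar j + 1 / 4 * b j ^ 2 + D.m j x + D.ψ j |x|) * x / b j

/-- `ρ_j (s) = ψ_j (s) s²`. -/
def ρ (D : Design) (j : ℕ) (s : ℝ) : ℝ := D.ψ j s * s ^ 2

/-- The inverse of `ρ_j` as a map of `[0, ∞)`. -/
noncomputable def ρInv (D : Design) (j : ℕ) : ℝ → ℝ :=
  Function.invFunOn (D.ρ j) (Ici 0)

/-- `ρ_0⁻¹ (k_0 s²)` for the first stage and `2 ρ_j⁻¹ (k_j s²)` for `j ≥ 1`. -/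
noncomputable def gainX (D : Design) : ℕ → ℝ → ℝ
  | 0, s => D.ρInv 0 (D.k 0 * s ^ 2)
  | j + 1, s => 2 * D.ρInv (j + 1) (D.k (j + 1) * s ^ 2)

/-- The gain from `x̄̂_j` to `ẑ_j`, for gains `γbar j` of the `z_j`-subsystem with respect to
`x̄̂_j`; for the first stage it is `γzx 0` because `x̄_0 = x_0`. For `j ≥ 1` it is
`2 max {γbar_j, g_{j-1}, γzz_j ∘ g_{j-1}}` with `g_{j-1} = gainZX (j-1) ∘ gainX (j-1)`. -/
noncomputable def gainZX (D : Design) (γbar : ℕ → ℝ → ℝ) : ℕ → ℝ → ℝ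
  | 0, s => D.γzx 0 s
  | j + 1, s => 2 * max (γbar (j + 1) s)
      (max (D.gainZX γbar j (D.gainX j s)) (D.γzz (j + 1) (D.gainZX γbar j (D.gainX j s))))

/-- The gain from `x̄_{j+1}` to `ẑ_j`. -/
noncomputable def gainZ (D : Design) (γbar : ℕ → ℝ → ℝ) (j : ℕ) (s : ℝ) : ℝ :=
  D.gainZX γbar j (D.gainX j s)

/-- The inequality imposed on `ψ_j`. -/
def PsiCondition (D : Design) (γbar : ℕ → ℝ → ℝ) : ℕ → Prop
  | 0 => ∀ s, 0 < s →
      D.k 0 * max (D.ιBar 0 (D.γzx 0 s) / s ^ 2) 1 < D.ψ 0 s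
  | j + 1 => ∀ s, 0 < s →
      D.k (j + 1) * max (D.mBar (j + 1) s / s ^ 2)
        (max (D.ιBar (j + 1) (D.gainZX γbar (j + 1) (2 * s)) / s ^ 2) 2) < D.ψ (j + 1) s

/-- Requirements on the selected functions and constants for the stages `j < ℓ`, apart from
the inequalities involving the plant and the gains. -/
structure Regular (D : Design) (ℓ : ℕ) : Prop where
  contDiff_ι : ∀ j, j < ℓ → ContDiffOn ℝ 1 (D.ι j) (Ici 0)
  contDiff_mt : ∀ j, j < ℓ → ContDiffOn ℝ 1 (D.mt j) (Ici 0)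
  contDiff_m : ∀ j, j < ℓ → ContDiff ℝ 1 (D.m j)
  contDiff_ψ : ∀ j, j < ℓ → ContDiff ℝ 1 (D.ψ j)
  ι_nonneg : ∀ j, j < ℓ → ∀ s, 0 ≤ s → 0 ≤ D.ι j s
  mt_nonneg : ∀ j, j < ℓ → ∀ s, 0 ≤ s → 0 ≤ D.mt j s
  m_nonneg : ∀ j, j < ℓ → ∀ s, 0 ≤ D.m j s
  ψ_even : ∀ j, j < ℓ → ∀ s, D.ψ j (-s) = D.ψ j s
  ρ_classK : ∀ j, j < ℓ → IsClassK (D.ρ j)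
  c_pos : ∀ j, j < ℓ → 0 < D.c j
  two_lt_k : ∀ j, j < ℓ → j = 0 → 2 < D.k j
  three_lt_k : ∀ j, j < ℓ → 0 < j → 3 < D.k j

end Design

/-- Every `z_j`-subsystem is ISS with `K∞` gains of finite slope at zero. -/
def LTSystem.ISSAssumption (P : LTSystem) (D : Design) : Prop :=
  ∀ j, j < P.ℓ →
    IsClassKInf (D.γzz j) ∧ IsClassKInf (D.γzx j) ∧
    HasFiniteSlopeAtZero (D.γzz j) ∧ HasFiniteSlopeAtZero (D.γzx j) ∧
    P.ZSubsystemISS j (D.γzz j) (D.γzx j)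

/-- `γ` is a `K∞` gain of the `z_j`-subsystem with respect to the transformed input `x̄̂_j`,
of finite slope at zero. -/
def LTSystem.IsBarGain (P : LTSystem) (D : Design) (j : ℕ) (γ : ℝ → ℝ) : Prop :=
  IsClassKInf γ ∧ HasFiniteSlopeAtZero γ ∧ P.ZSubsystemISSBar (D.θ P.b) j (D.γzz j) γ

/-- The bounds on the drifts `f̄_j` satisfied by the selected `ι_j`, `m̃_j`, `m_j`. For `j = 0` the
`m̃` term vanishes. -/
def LTSystem.DriftBound (P : LTSystem) (D : Design) : Prop :=
  ∀ j, j < P.ℓ → ∀ (z : P.ZState) (y : ℕ → ℝ), ∀ w ∈ P.W,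
    |P.fBar (D.θ P.b) j z y w| ≤
      D.ι j ‖zHead (j + 1) z‖ * ‖zHead (j + 1) z‖
        + D.mt j ‖xHead j y‖ * ‖xHead j y‖ + D.m j (y j) * |y j|

/-!
The theorem is an induction over the stages, each step being a cascade followed by a small-gain
argument.

With `Z = ‖ẑ_j‖`, `X = ‖x̄̂_{j-1}‖`, `u = x̄_{j+1}`, completing squares gives (`dissipation`)
`(x̄_j² / 2)' ≤ -ρ_j(|x̄_j|) + ῑ_j(Z) + m̄_j(X) + u²`. As `k_j` exceeds the number of coupling
terms, `|x̄_j|` decreases at a uniform rate down to any level `m` for which `ρ_j(m)` dominates `k_j`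
times each coupling (`exists_decay`). The gain from `u` is therefore `N_j(s) = ρ_j⁻¹(k_j s²)`. In
the other direction, the previous stage gives `X` the gain identity and `ẑ_{j-1}` the gain of that
stage from `x̄_j`; feeding these to the ISS estimate of the `z_j`-subsystem gives `Z` the gain
`Γ(s) = γ_{Z_j}^{X_j}(2s)` (`HasKLEstimate.cascade`); for the first stage `Γ = γ_{z_0}^x`. The
condition on `ψ_j` puts the gains of both loops, through `Z` and through `X`, below the identity, so
`x̄_j` has the gain `N_j` from `u`, and `Z` has the gain `Γ ∘ N_j` (`Settles.small_gain`).

All estimates have maxima instead of sums, so no slack is lost and the gains come out exactly as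
prescribed. The `KL` bounds are handled through their `ε`-`T` content (`Settles`): an overshoot
level that depends on the initial size and is small with it, and uniform attractivity. Restarting an
estimate at a later time needs a bound for the state there, which also depends on the input; this is
harmless because an output above its gain term forces, the gain being unbounded, the input to be
bounded in terms of the initial size. `exists_isClassKL_of_bounds` turns this back into a `KL`
function. In the small-gain argument the attained levels of `|x̄_j|` are compared with their
infimum, which cannot be positive since the continuous loop gain is below the identity.

The loop gain uses the running maxima of `ῑ_j ∘ Γ` and `m̄_j`, as `ι_j` and `m̃_j` need not be
monotone (`exists_loop_gain`). The gain from `u` to the stack `(x̄̂_{j-1}, x̄_j)` is `√2 N_j`, which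
is below the identity because `ψ_j > 2 k_j` for the later stages.

Gains with respect to the transformed input exist because the coordinate change has an inverse
bounded by a class `K∞` function of finite slope (`exists_xHead_bound`), which can be composed with
the given gain.
-/

/-! ### Comparison functions -/

theorem IsClassK.monotoneOn {α : ℝ → ℝ} (h : IsClassK α) : MonotoneOn α (Ici 0) :=
  h.2.1.monotoneOn

theorem IsClassK.mono {α : ℝ → ℝ} (h : IsClassK α) {s t : ℝ} (hs : 0 ≤ s) (hst : s ≤ t) :
    α s ≤ α t :=
  h.monotoneOn hs (hs.trans hst) hst

theorem IsClassK.nonneg {α : ℝ → ℝ} (h : IsClassK α) {s : ℝ} (hs : 0 ≤ s) : 0 ≤ α s := by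
  simpa [h.2.2] using h.mono le_rfl hs

theorem IsClassK.pos {α : ℝ → ℝ} (h : IsClassK α) {s : ℝ} (hs : 0 < s) : 0 < α s := by
  simpa [h.2.2] using h.2.1 (mem_Ici.2 le_rfl) (mem_Ici.2 hs.le) hs

theorem IsClassK.map_max {α : ℝ → ℝ} (h : IsClassK α) {s t : ℝ} (hs : 0 ≤ s) (ht : 0 ≤ t) :
    α (max s t) = max (α s) (α t) :=
  h.monotoneOn.map_max hs ht

theorem IsClassK.comp {α β : ℝ → ℝ} (hα : IsClassK α) (hβ : IsClassK β) :
    IsClassK (fun s => α (β s)) :=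
  ⟨hα.1.comp hβ.1 fun _ hs => hβ.nonneg hs,
    fun _ hs _ ht hst => hα.2.1 (hβ.nonneg hs) (hβ.nonneg ht) (hβ.2.1 hs ht hst),
    by simp [hα.2.2, hβ.2.2]⟩

theorem IsClassK.sup {α β : ℝ → ℝ} (hα : IsClassK α) (hβ : IsClassK β) :
    IsClassK (fun s => max (α s) (β s)) :=
  ⟨hα.1.sup hβ.1,
    fun _ hs _ ht hst => max_lt_max (hα.2.1 hs ht hst) (hβ.2.1 hs ht hst),
    by simp [hα.2.2, hβ.2.2]⟩

theorem IsClassK.const_mul {α : ℝ → ℝ} (hα : IsClassK α) {c : ℝ} (hc : 0 < c) :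
    IsClassK (fun s => c * α s) :=
  ⟨continuousOn_const.mul hα.1,
    fun _ hs _ ht hst => mul_lt_mul_of_pos_left (hα.2.1 hs ht hst) hc, by simp [hα.2.2]⟩

/-- Values of a class `K` function are arbitrarily small near zero. -/
theorem IsClassK.exists_pos_le {α : ℝ → ℝ} (h : IsClassK α) {ε : ℝ} (hε : 0 < ε) :
    ∃ η, 0 < η ∧ α η ≤ ε := by
  have h1 : Tendsto α (𝓝[>] 0) (𝓝 0) := by
    have := h.1 0 (mem_Ici.2 le_rfl)
    rw [ContinuousWithinAt, h.2.2] at this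
    exact this.mono_left (nhdsWithin_mono _ Ioi_subset_Ici_self)
  obtain ⟨η, h2, h3⟩ := ((h1.eventually_le_const hε).and self_mem_nhdsWithin).exists
  exact ⟨η, h3, h2⟩

theorem IsClassKInf.id : IsClassKInf (fun s => s) :=
  ⟨⟨continuousOn_id, strictMonoOn_id, rfl⟩, tendsto_id⟩

theorem IsClassKInf.comp {α β : ℝ → ℝ} (hα : IsClassKInf α) (hβ : IsClassKInf β) :
    IsClassKInf (fun s => α (β s)) :=
  ⟨hα.1.comp hβ.1, hα.2.comp hβ.2⟩

theorem IsClassKInf.sup {α β : ℝ → ℝ} (hα : IsClassKInf α) (hβ : IsClassK β) :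
    IsClassKInf (fun s => max (α s) (β s)) :=
  ⟨hα.1.sup hβ, tendsto_atTop_mono (fun _ => le_max_left _ _) hα.2⟩

theorem IsClassKInf.const_mul {α : ℝ → ℝ} (hα : IsClassKInf α) {c : ℝ} (hc : 0 < c) :
    IsClassKInf (fun s => c * α s) :=
  ⟨hα.1.const_mul hc, hα.2.const_mul_atTop hc⟩

theorem IsClassKInf.add {α β : ℝ → ℝ} (hα : IsClassKInf α) (hβ : IsClassK β) :
    IsClassKInf (fun s => α s + β s) := by
  refine ⟨⟨hα.1.1.add hβ.1,
    fun _ hs _ ht hst => add_lt_add (hα.1.2.1 hs ht hst) (hβ.2.1 hs ht hst),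
    by simp [hα.1.2.2, hβ.2.2]⟩, ?_⟩
  refine tendsto_atTop_mono' _ ?_ hα.2
  filter_upwards [eventually_ge_atTop 0] with s hs
  exact le_add_of_nonneg_right (hβ.nonneg hs)

theorem IsClassKInf.const_mul_sq {c : ℝ} (hc : 0 < c) : IsClassKInf (fun s => c * s ^ 2) := by
  refine IsClassKInf.const_mul ⟨⟨by fun_prop, ?_, by simp⟩, tendsto_pow_atTop two_ne_zero⟩ hc
  intro s hs t _ hst
  exact pow_lt_pow_left₀ hst hs two_ne_zero

theorem IsClassKInf.exists_ge {α : ℝ → ℝ} (h : IsClassKInf α) (R : ℝ) :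
    ∃ M, 0 < M ∧ R ≤ α M := by
  obtain ⟨M, h1, h2⟩ := ((h.2.eventually_ge_atTop R).and (eventually_gt_atTop 0)).exists
  exact ⟨M, h2, h1⟩

theorem IsClassKInf.surjOn {α : ℝ → ℝ} (h : IsClassKInf α) : SurjOn α (Ici 0) (Ici 0) := by
  intro y hy
  obtain ⟨M, hM, hyM⟩ := h.exists_ge y
  have := intermediate_value_Icc hM.le (h.1.1.mono Icc_subset_Ici_self)
  obtain ⟨s, hs, rfl⟩ := this ⟨by simpa [h.1.2.2] using hy, hyM⟩
  exact ⟨s, hs.1, rfl⟩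

theorem IsClassKInf.invFunOn_nonneg {α : ℝ → ℝ} (h : IsClassKInf α) {y : ℝ} (hy : 0 ≤ y) :
    0 ≤ Function.invFunOn α (Ici 0) y :=
  Function.invFunOn_mem (h.surjOn hy)

theorem IsClassKInf.apply_invFunOn {α : ℝ → ℝ} (h : IsClassKInf α) {y : ℝ} (hy : 0 ≤ y) :
    α (Function.invFunOn α (Ici 0) y) = y :=
  Function.invFunOn_eq (h.surjOn hy)

theorem IsClassKInf.invFunOn_apply {α : ℝ → ℝ} (h : IsClassKInf α) {s : ℝ} (hs : 0 ≤ s) :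
    Function.invFunOn α (Ici 0) (α s) = s :=
  h.1.2.1.injOn (h.invFunOn_nonneg (h.1.nonneg hs)) hs (h.apply_invFunOn (h.1.nonneg hs))

theorem IsClassKInf.lt_invFunOn_iff {α : ℝ → ℝ} (h : IsClassKInf α) {s y : ℝ} (hs : 0 ≤ s)
    (hy : 0 ≤ y) : s < Function.invFunOn α (Ici 0) y ↔ α s < y := by
  rw [← h.1.2.1.lt_iff_lt hs (h.invFunOn_nonneg hy), h.apply_invFunOn hy]

theorem IsClassKInf.invFunOn_lt_iff {α : ℝ → ℝ} (h : IsClassKInf α) {s y : ℝ} (hs : 0 ≤ s)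
    (hy : 0 ≤ y) : Function.invFunOn α (Ici 0) y < s ↔ y < α s := by
  rw [← h.1.2.1.lt_iff_lt (h.invFunOn_nonneg hy) hs, h.apply_invFunOn hy]

theorem IsClassKInf.invFunOn {α : ℝ → ℝ} (h : IsClassKInf α) :
    IsClassKInf (Function.invFunOn α (Ici 0)) := by
  refine ⟨⟨?_, ?_, ?_⟩, ?_⟩
  · intro y hy
    refine tendsto_order.2 ⟨fun a ha => ?_, fun a ha => ?_⟩
    · rcases lt_or_ge a 0 with ha0 | ha0
      · filter_upwards [self_mem_nhdsWithin] with x hx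
        exact ha0.trans_le (h.invFunOn_nonneg hx)
      · filter_upwards [self_mem_nhdsWithin,
          mem_nhdsWithin_of_mem_nhds (lt_mem_nhds ((h.lt_invFunOn_iff ha0 hy).1 ha))] with x hx hx'
        exact (h.lt_invFunOn_iff ha0 hx).2 hx'
    · have ha0 : 0 ≤ a := (h.invFunOn_nonneg hy).trans ha.le
      filter_upwards [self_mem_nhdsWithin,
        mem_nhdsWithin_of_mem_nhds (gt_mem_nhds ((h.invFunOn_lt_iff ha0 hy).1 ha))] with x hx hx'
      exact (h.invFunOn_lt_iff ha0 hx).2 hx'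
  · intro x hx y hy hxy
    rwa [h.lt_invFunOn_iff (h.invFunOn_nonneg hx) hy, h.apply_invFunOn hx]
  · simpa [h.1.2.2] using h.invFunOn_apply (le_refl (0 : ℝ))
  · refine tendsto_atTop.2 fun b => ?_
    filter_upwards [eventually_gt_atTop (α (max b 0)), eventually_ge_atTop 0] with y hy hy0
    exact (le_max_left b 0).trans
      ((h.lt_invFunOn_iff (le_max_right b 0) hy0).2 hy).le

/-! ### Finite slope at zero -/

theorem IsClassK.tendsto_nhdsGT {α : ℝ → ℝ} (h : IsClassK α) :
    Tendsto α (𝓝[>] 0) (𝓝[>] 0) := by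
  refine tendsto_nhdsWithin_iff.2 ⟨?_, ?_⟩
  · have := h.1 0 (mem_Ici.2 le_rfl)
    rw [ContinuousWithinAt, h.2.2] at this
    exact this.mono_left (nhdsWithin_mono _ Ioi_subset_Ici_self)
  · filter_upwards [self_mem_nhdsWithin] with s hs using h.pos hs

theorem HasFiniteSlopeAtZero.comp {α β : ℝ → ℝ} (hα : HasFiniteSlopeAtZero α)
    (hβ : HasFiniteSlopeAtZero β) (hβK : IsClassK β) :
    HasFiniteSlopeAtZero (fun s => α (β s)) := by
  obtain ⟨L, hL⟩ := hα
  obtain ⟨L', hL'⟩ := hβ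
  refine ⟨L * L', ((hL.comp hβK.tendsto_nhdsGT).mul hL').congr' ?_⟩
  filter_upwards [self_mem_nhdsWithin] with s hs
  have := (hβK.pos hs).ne'
  simp only [Function.comp]
  field_simp

theorem HasFiniteSlopeAtZero.sup {α β : ℝ → ℝ} (hα : HasFiniteSlopeAtZero α)
    (hβ : HasFiniteSlopeAtZero β) : HasFiniteSlopeAtZero (fun s => max (α s) (β s)) := by
  obtain ⟨L, hL⟩ := hα
  obtain ⟨L', hL'⟩ := hβ
  refine ⟨max L L', (hL.max hL').congr' ?_⟩
  filter_upwards [self_mem_nhdsWithin] with s hs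
  exact (max_div_div_right (le_of_lt hs) _ _)

theorem HasFiniteSlopeAtZero.const_mul {α : ℝ → ℝ} (hα : HasFiniteSlopeAtZero α) (c : ℝ) :
    HasFiniteSlopeAtZero (fun s => c * α s) := by
  obtain ⟨L, hL⟩ := hα
  exact ⟨c * L, (hL.const_mul c).congr fun s => by ring⟩

theorem HasFiniteSlopeAtZero.add {α β : ℝ → ℝ} (hα : HasFiniteSlopeAtZero α)
    (hβ : HasFiniteSlopeAtZero β) : HasFiniteSlopeAtZero (fun s => α s + β s) := by
  obtain ⟨L, hL⟩ := hα
  obtain ⟨L', hL'⟩ := hβ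
  exact ⟨L + L', (hL.add hL').congr fun s => (add_div _ _ _).symm⟩

theorem HasFiniteSlopeAtZero.id : HasFiniteSlopeAtZero (fun s => s) := by
  refine ⟨1, tendsto_const_nhds.congr' ?_⟩
  filter_upwards [self_mem_nhdsWithin] with s hs
  exact (div_self (ne_of_gt hs)).symm

/-- If `ψ` is continuous and positive at zero, the solution `r` of `ψ(r) r² = k s²` has slope
`√(k / ψ(0))` at `s = 0`. -/
theorem HasFiniteSlopeAtZero.of_mul_sq_eq {ψ N : ℝ → ℝ} {k : ℝ} (hN : IsClassK N)
    (hψ : ContinuousAt ψ 0) (hψ0 : 0 < ψ 0) (h : ∀ s, 0 < s → ψ (N s) * N s ^ 2 = k * s ^ 2) :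
    HasFiniteSlopeAtZero N := by
  refine ⟨√(k / ψ 0), ?_⟩
  have h1 : Tendsto (fun s => ψ (N s)) (𝓝[>] 0) (𝓝 (ψ 0)) :=
    hψ.tendsto.comp (hN.tendsto_nhdsGT.mono_right nhdsWithin_le_nhds)
  refine ((tendsto_const_nhds.div h1 hψ0.ne').sqrt).congr' ?_
  filter_upwards [self_mem_nhdsWithin, h1.eventually_const_lt hψ0] with s hs hs'
  have hs : 0 < s := hs
  have hN0 := hN.pos hs
  rw [← Real.sqrt_sq (div_pos hN0 hs).le]
  congr 1
  simp only [Pi.div_apply]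
  have := h s hs
  field_simp
  linarith

/-! ### Monotone envelopes -/

/-- A continuous function on `[0, ∞)` has a continuous monotone majorant: its running maximum
`s ↦ max_{[0, s]} h`. The value of the majorant at `s` is attained by `h` on `[0, s]`. -/
theorem exists_continuous_monotone_envelope {h : ℝ → ℝ} (hc : ContinuousOn h (Ici 0)) :
    ∃ F : ℝ → ℝ, ContinuousOn F (Ici 0) ∧ MonotoneOn F (Ici 0) ∧
      (∀ s b, 0 ≤ s → s ≤ b → h s ≤ F b) ∧ ∀ b, 0 ≤ b → ∃ s, 0 ≤ s ∧ s ≤ b ∧ F b = h s := by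
  have hc' : Continuous (fun s => h (max s 0)) :=
    hc.comp_continuous (by fun_prop) fun s => le_max_right s 0
  let f : ℝ → ℝ → ℝ := fun b τ => h (max (b * τ) 0)
  have hf : Continuous ↿f := hc'.comp (continuous_fst.mul continuous_snd)
  have hle : ∀ s b, 0 ≤ s → s ≤ b → h s ≤ sSup (f b '' Icc 0 1) := by
    intro s b hs hb
    refine le_csSup (isCompact_Icc.image (by fun_prop)).bddAbove ?_
    rcases hs.eq_or_lt with rfl | hs
    · exact ⟨0, by simp, by simp [f]⟩
    · have hb0 := hs.trans_le hb
      refine ⟨s / b, ⟨by positivity, (div_le_one hb0).2 hb⟩, ?_⟩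
      simp only [f, mul_div_cancel₀ s hb0.ne', max_eq_left hs.le]
  have hat : ∀ b, 0 ≤ b → ∃ s, 0 ≤ s ∧ s ≤ b ∧ sSup (f b '' Icc 0 1) = h s := by
    intro b hb
    obtain ⟨τ, hτ, h1, -⟩ := isCompact_Icc.exists_sSup_image_eq_and_ge
      (nonempty_Icc.2 (zero_le_one (α := ℝ))) (f := f b) (by fun_prop)
    refine ⟨b * τ, mul_nonneg hb hτ.1, mul_le_of_le_one_right hb hτ.2, ?_⟩
    rw [h1]
    simp only [f, max_eq_left (mul_nonneg hb hτ.1)]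
  refine ⟨fun b => sSup (f b '' Icc 0 1), (isCompact_Icc.continuous_sSup hf).continuousOn, ?_,
    hle, hat⟩
  intro a ha b hb hab
  obtain ⟨s, hs, hsa, h1⟩ := hat a ha
  simp only [h1]
  exact hle s b hs (hsa.trans hab)

/-! ### Class `KL` bounds -/

theorem IsClassKL.mono {β : ℝ → ℝ → ℝ} (h : IsClassKL β) {r s t u : ℝ} (hr : 0 ≤ r) (hrs : r ≤ s)
    (ht : 0 ≤ t) (htu : t ≤ u) : β r u ≤ β s t :=
  ((h.1 u (ht.trans htu)).mono hr hrs).trans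
    ((h.2 s (hr.trans hrs)).1 ht (mem_Ici.2 (ht.trans htu)) htu)

theorem IsClassKL.exists_time {β : ℝ → ℝ → ℝ} (h : IsClassKL β) {R ε : ℝ} (hR : 0 ≤ R)
    (hε : 0 < ε) : ∃ T, 0 ≤ T ∧ ∀ r t, 0 ≤ r → r ≤ R → T ≤ t → β r t ≤ ε := by
  obtain ⟨T, h1, h2⟩ :=
    (((h.2 R hR).2.eventually_le_const hε).and (eventually_ge_atTop 0)).exists
  exact ⟨T, h2, fun r t hr hrR ht => (h.mono hr hrR h2 ht).trans h1⟩

theorem IsClassKL.exists_small {β : ℝ → ℝ → ℝ} (h : IsClassKL β) {ε : ℝ} (hε : 0 < ε) :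
    ∃ η, 0 < η ∧ ∀ r t, 0 ≤ r → r ≤ η → 0 ≤ t → β r t ≤ ε := by
  obtain ⟨η, h1, h2⟩ := (h.1 0 le_rfl).exists_pos_le hε
  exact ⟨η, h1, fun r t hr hrη ht => (h.mono hr hrη le_rfl ht).trans h2⟩

/-- Uniform boundedness, uniform smallness for small data, and uniform attractivity together give
a class `KL` bound. With `B(s, t)` the supremum of the values having data at most `s` and elapsed
time at least `t`, the bound is `∫₁² B(sλ, t) dλ + s e^{-t}`: the average makes the monotone
function `B(·, t)` continuous, and the second term makes it strictly increasing. -/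
theorem exists_isClassKL_of_bounds {ι : Type*} {r τ v : ι → ℝ} (hr : ∀ i, 0 ≤ r i)
    (hbdd : ∀ R, ∃ M, ∀ i, r i ≤ R → v i ≤ M)
    (hsmall : ∀ ε, 0 < ε → ∃ η, 0 < η ∧ ∀ i, r i ≤ η → v i ≤ ε)
    (hattr : ∀ R ε, 0 < ε → ∃ T, ∀ i, r i ≤ R → T ≤ τ i → v i ≤ ε) :
    ∃ β, IsClassKL β ∧ ∀ i, v i ≤ β (r i) (τ i) := by
  let S : ℝ → ℝ → Set ℝ := fun s t => insert 0 (v '' {i | r i ≤ s ∧ t ≤ τ i})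
  let B : ℝ → ℝ → ℝ := fun s t => sSup (S s t)
  have hS : ∀ s t, BddAbove (S s t) := by
    intro s t
    obtain ⟨M, hM⟩ := hbdd s
    refine ⟨max M 0, ?_⟩
    rintro _ (rfl | ⟨i, hi, rfl⟩)
    exacts [le_max_right _ _, (hM i hi.1).trans (le_max_left _ _)]
  have hB0 : ∀ s t, 0 ≤ B s t := fun s t => le_csSup (hS s t) (mem_insert _ _)
  have hBle : ∀ s t ε, 0 ≤ ε → (∀ i, r i ≤ s → t ≤ τ i → v i ≤ ε) → B s t ≤ ε := by
    intro s t ε hε h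
    refine csSup_le (insert_nonempty _ _) ?_
    rintro _ (rfl | ⟨i, hi, rfl⟩)
    exacts [hε, h i hi.1 hi.2]
  have hBs : ∀ t, Monotone fun s => B s t := fun t s s' hs =>
    csSup_le_csSup (hS s' t) (insert_nonempty _ _)
      (insert_subset_insert (image_mono fun i hi => ⟨hi.1.trans hs, hi.2⟩))
  have hBt : ∀ s, Antitone fun t => B s t := fun s t t' ht =>
    csSup_le_csSup (hS s t) (insert_nonempty _ _)
      (insert_subset_insert (image_mono fun i hi => ⟨hi.1, ht.trans hi.2⟩))
  have hint : ∀ t s, 0 ≤ s →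
      IntervalIntegrable (fun l => B (s * l) t) MeasureTheory.volume 1 2 := fun t s hs =>
    Monotone.intervalIntegrable fun l l' hl => hBs t (mul_le_mul_of_nonneg_left hl hs)
  let A : ℝ → ℝ → ℝ := fun s t => ∫ l in (1 : ℝ)..2, B (s * l) t
  have hAle : ∀ s t ε, 0 ≤ s → B (s * 2) t ≤ ε → A s t ≤ ε := by
    intro s t ε hs hε
    have h := intervalIntegral.integral_mono_on (g := fun _ => ε) one_le_two (hint t s hs)
      intervalIntegrable_const
      fun l hl => (hBs t (mul_le_mul_of_nonneg_left hl.2 hs)).trans hε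
    refine h.trans (le_of_eq ?_)
    rw [intervalIntegral.integral_const, smul_eq_mul]
    ring
  have hleA : ∀ s t, 0 ≤ s → B s t ≤ A s t := by
    intro s t hs
    have h := intervalIntegral.integral_mono_on (f := fun _ => B s t) one_le_two
      intervalIntegrable_const (hint t s hs)
      fun l hl => hBs t (le_mul_of_one_le_right hs hl.1)
    refine le_trans (le_of_eq ?_) h
    rw [intervalIntegral.integral_const, smul_eq_mul]
    ring
  have hA0 : ∀ s t, 0 ≤ s → 0 ≤ A s t := fun s t hs => (hB0 s t).trans (hleA s t hs)
  have hAs : ∀ t, MonotoneOn (fun s => A s t) (Ici 0) := fun t s hs s' hs' hss =>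
    intervalIntegral.integral_mono_on one_le_two (hint t s hs) (hint t s' hs')
      fun l hl => hBs t (mul_le_mul_of_nonneg_right hss (by linarith [hl.1]))
  have hAt : ∀ s, 0 ≤ s → Antitone (A s) := fun s hs t t' ht =>
    intervalIntegral.integral_mono_on one_le_two (hint t' s hs) (hint t s hs)
      fun l _ => hBt (s * l) ht
  have hAsmall : ∀ t, 0 ≤ t → ∀ ε, 0 < ε → ∃ η, 0 < η ∧ ∀ s, 0 ≤ s → s ≤ η → A s t ≤ ε := by
    intro t _ ε hε
    obtain ⟨η, hη, h⟩ := hsmall ε hε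
    refine ⟨η / 2, by positivity, fun s hs hsη => hAle s t ε hs ?_⟩
    exact hBle _ _ _ hε.le fun i hi _ => h i (by linarith)
  have hAzero : ∀ t, 0 ≤ t → A 0 t = 0 := by
    intro t ht
    refine le_antisymm (le_of_forall_pos_le_add fun ε hε => ?_) (hA0 0 t le_rfl)
    obtain ⟨η, hη, h⟩ := hAsmall t ht ε hε
    simpa using h 0 le_rfl hη.le
  have hAcont : ∀ t, 0 ≤ t → ContinuousOn (fun s => A s t) (Ici 0) := by
    intro t ht s hs
    rcases (mem_Ici.1 hs).eq_or_lt with rfl | hs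
    · rw [ContinuousWithinAt, hAzero t ht]
      refine tendsto_order.2 ⟨fun a ha => ?_, fun a ha => ?_⟩
      · filter_upwards [self_mem_nhdsWithin] with x hx using ha.trans_le (hA0 x t hx)
      · obtain ⟨η, hη, h⟩ := hAsmall t ht (a / 2) (by linarith)
        filter_upwards [self_mem_nhdsWithin, mem_nhdsWithin_of_mem_nhds (gt_mem_nhds hη)]
          with x hx hx'
        exact (h x hx (le_of_lt hx')).trans_lt (by linarith)
    · refine ContinuousAt.continuousWithinAt ?_
      have hI : ∀ a b, IntervalIntegrable (fun l => B l t) MeasureTheory.volume a b :=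
        fun a b => (hBs t).intervalIntegrable
      have hP := intervalIntegral.continuous_primitive hI 0
      have h1 : ContinuousAt (fun s => s⁻¹ *
          ((∫ l in (0 : ℝ)..s * 2, B l t) - ∫ l in (0 : ℝ)..s * 1, B l t)) s :=
        (continuousAt_inv₀ hs.ne').mul
          ((hP.comp (by fun_prop : Continuous fun s : ℝ => s * 2)).sub
            (hP.comp (by fun_prop : Continuous fun s : ℝ => s * 1))).continuousAt
      refine h1.congr ?_
      filter_upwards [lt_mem_nhds hs] with x hx
      rw [intervalIntegral.integral_interval_sub_left (hI _ _) (hI _ _)]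
      exact (intervalIntegral.integral_comp_mul_left (fun l => B l t) hx.ne').symm
  refine ⟨fun s t => A s t + s * Real.exp (-t), ⟨fun t ht => ⟨?_, ?_, ?_⟩, fun s hs => ⟨?_, ?_⟩⟩,
    fun i => ?_⟩
  · exact (hAcont t ht).add (by fun_prop)
  · intro s hs s' hs' hss
    exact add_lt_add_of_le_of_lt (hAs t hs hs' hss.le)
      (mul_lt_mul_of_pos_right hss (Real.exp_pos _))
  · simp [hAzero t ht]
  · intro t _ t' _ htt
    exact add_le_add (hAt s hs htt)
      (mul_le_mul_of_nonneg_left (Real.exp_le_exp.2 (neg_le_neg htt)) hs)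
  · have h1 : Tendsto (A s) atTop (𝓝 0) := by
      refine tendsto_order.2 ⟨fun a ha => ?_, fun a ha => ?_⟩
      · exact Eventually.of_forall fun t => ha.trans_le (hA0 s t hs)
      · obtain ⟨T, hT⟩ := hattr (s * 2) (a / 2) (by linarith)
        filter_upwards [eventually_ge_atTop T] with t ht
        refine (hAle s t (a / 2) hs ?_).trans_lt (by linarith)
        exact hBle _ _ _ (by linarith) fun i hi hi' => hT i hi (ht.trans hi')
    have h2 : Tendsto (fun t : ℝ => s * Real.exp (-t)) atTop (𝓝 0) := by
      simpa using (Real.tendsto_exp_neg_atTop_nhds_zero).const_mul s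
    simpa using h1.add h2
  · have h1 : v i ≤ B (r i) (τ i) :=
      le_csSup (hS _ _) (mem_insert_of_mem _ ⟨i, ⟨le_rfl, le_rfl⟩, rfl⟩)
    have h2 := hleA (r i) (τ i) (hr i)
    have h3 := mul_nonneg (hr i) (Real.exp_pos (-τ i)).le
    linarith

/-! ### Families of trajectories -/

/-- The signal `v i` is bounded by `B` on the subinterval `[t₁, t]` of the interval
`[lo i, hi i]` on which the trajectory `i` is defined. -/
structure BoundedOnSegment {I : Type*} (lo hi : I → ℝ) (v : I → ℝ → ℝ) (i : I) (t₁ t B : ℝ) :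
    Prop where
  lo_le : lo i ≤ t₁
  le : t₁ ≤ t
  le_hi : t ≤ hi i
  nonneg : 0 ≤ B
  bound : ∀ s ∈ Icc t₁ t, v i s ≤ B

theorem BoundedOnSegment.restrict {I : Type*} {lo hi : I → ℝ} {v : I → ℝ → ℝ} {i : I}
    {t₁ t B t₁' t' : ℝ} (h : BoundedOnSegment lo hi v i t₁ t B) (h₁ : t₁ ≤ t₁') (h₂ : t₁' ≤ t')
    (h₃ : t' ≤ t) : BoundedOnSegment lo hi v i t₁' t' B :=
  ⟨h.lo_le.trans h₁, h₂, h₃.trans h.le_hi, h.nonneg,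
    fun s hs => h.bound s ⟨h₁.trans hs.1, hs.2.trans h₃⟩⟩

/-- A max-form input-to-state estimate for a family of trajectories indexed by `I`: the output `y`
is bounded by a class `KL` function of the state size `σ` at the start of the segment, or by the
gain `γ` applied to any bound for the input `v`. The estimate may be restarted at any time. -/
def HasKLEstimate {I : Type*} (lo hi : I → ℝ) (σ y v : I → ℝ → ℝ) (γ : ℝ → ℝ) : Prop :=
  ∃ β, IsClassKL β ∧ ∀ i t₁ t B, BoundedOnSegment lo hi v i t₁ t B →
    y i t ≤ max (β (σ i t₁) (t - t₁)) (γ B)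

/-- `Q i t b` says that the trajectory `i` is at time `t` within level `b`. The family settles with
gain `N` if, for input bound `B`, the level `max M (N B)` is never exceeded for some `M` depending
on the initial size only, with `M` arbitrarily small for small initial sizes, and if `M` can be
replaced by an arbitrarily small level after a time that is uniform in bounded initial sizes and
bounded inputs. -/
structure Settles {I : Type*} (lo hi : I → ℝ) (σ v : I → ℝ → ℝ) (N : ℝ → ℝ)
    (Q : I → ℝ → ℝ → Prop) : Prop where
  bounded : ∀ R, ∃ M, 0 < M ∧ ∀ i t₁ t B, BoundedOnSegment lo hi v i t₁ t B → σ i t₁ ≤ R →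
    Q i t (max M (N B))
  small : ∀ M, 0 < M → ∃ η, 0 < η ∧ ∀ i t₁ t B, BoundedOnSegment lo hi v i t₁ t B →
    σ i t₁ ≤ η → Q i t (max M (N B))
  attractive : ∀ R a, 0 < a → ∃ T, ∀ i t₁ t B, BoundedOnSegment lo hi v i t₁ t B → σ i t₁ ≤ R →
    B ≤ R → T ≤ t - t₁ → Q i t (max a (N B))

/-- Settling gives an estimate with the exact gain. Only the segments on which the output exceeds
the gain term matter, and on those the input bound is controlled by the initial size, because the
gain is unbounded. -/
theorem Settles.hasKLEstimate {I : Type*} {lo hi : I → ℝ} {σ v y : I → ℝ → ℝ} {N φ : ℝ → ℝ}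
    {Q : I → ℝ → ℝ → Prop} (h : Settles lo hi σ v N Q) (hσ : ∀ i t, 0 ≤ σ i t)
    (hN : IsClassKInf N) (hφ : IsClassKInf φ) (hQ : ∀ i t b, 0 ≤ b → Q i t b → y i t ≤ φ b) :
    HasKLEstimate lo hi σ y v (fun s => φ (N s)) := by
  have key : ∀ i t M B, 0 < M → 0 ≤ B → φ (N B) < y i t → Q i t (max M (N B)) → y i t ≤ φ M := by
    intro i t M B hM hB hlt hq
    have h1 := hQ i t _ (hM.le.trans (le_max_left _ _)) hq
    rw [hφ.1.map_max hM.le (hN.1.nonneg hB)] at h1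
    exact (le_max_iff.1 h1).resolve_right hlt.not_ge
  let J := {p : I × ℝ × ℝ × ℝ // BoundedOnSegment lo hi v p.1 p.2.1 p.2.2.1 p.2.2.2 ∧
    φ (N p.2.2.2) < y p.1 p.2.2.1}
  obtain ⟨β, hβ, hb⟩ := exists_isClassKL_of_bounds (ι := J) (r := fun p => σ p.1.1 p.1.2.1)
    (τ := fun p => p.1.2.2.1 - p.1.2.1) (v := fun p => y p.1.1 p.1.2.2.1) (fun p => hσ _ _)
    (by
      intro R
      obtain ⟨M, hM, h1⟩ := h.bounded R
      refine ⟨φ M, ?_⟩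
      rintro ⟨⟨i, t₁, t, B⟩, hs, hlt⟩ hR
      exact key i t M B hM hs.nonneg hlt (h1 i t₁ t B hs hR))
    (by
      intro ε hε
      obtain ⟨M, hM, hMε⟩ := hφ.1.exists_pos_le hε
      obtain ⟨η, hη, h1⟩ := h.small M hM
      refine ⟨η, hη, ?_⟩
      rintro ⟨⟨i, t₁, t, B⟩, hs, hlt⟩ hR
      exact (key i t M B hM hs.nonneg hlt (h1 i t₁ t B hs hR)).trans hMε)
    (by
      intro R ε hε
      obtain ⟨a, ha, haε⟩ := hφ.1.exists_pos_le hε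
      obtain ⟨M, hM, h1⟩ := h.bounded R
      obtain ⟨C, hC, hMC⟩ := (hφ.comp hN).exists_ge (φ M)
      obtain ⟨T, hT⟩ := h.attractive (max R C) a ha
      refine ⟨T, ?_⟩
      rintro ⟨⟨i, t₁, t, B⟩, hs, hlt⟩ hR ht
      refine (key i t a B ha hs.nonneg hlt (hT i t₁ t B hs (hR.trans (le_max_left _ _)) ?_
        ht)).trans haε
      refine le_trans (le_of_not_gt fun hCB => ?_) (le_max_right R C)
      have h2 := key i t M B hM hs.nonneg hlt (h1 i t₁ t B hs hR)
      have h3 := (hφ.comp hN).1.mono hC.le hCB.le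
      exact absurd (hlt.trans_le (h2.trans (hMC.trans h3))) (lt_irrefl _))
  refine ⟨β, hβ, fun i t₁ t B hs => ?_⟩
  by_cases hlt : φ (N B) < y i t
  · exact (hb ⟨(i, t₁, t, B), hs, hlt⟩).trans (le_max_left _ _)
  · exact (not_lt.1 hlt).trans (le_max_right _ _)

theorem HasKLEstimate.mono {I : Type*} {lo hi : I → ℝ} {σ σ' y y' v : I → ℝ → ℝ} {γ γ' : ℝ → ℝ}
    (h : HasKLEstimate lo hi σ y v γ) (hσ : ∀ i t, 0 ≤ σ i t) (hσσ' : ∀ i t, σ i t ≤ σ' i t)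
    (hy : ∀ i t, y' i t ≤ y i t) (hγ : ∀ s, 0 ≤ s → γ s ≤ γ' s) :
    HasKLEstimate lo hi σ' y' v γ' := by
  obtain ⟨β, hβ, hb⟩ := h
  refine ⟨β, hβ, fun i t₁ t B hs => (hy i t).trans ((hb i t₁ t B hs).trans ?_)⟩
  exact max_le_max (hβ.mono (hσ i t₁) (hσσ' i t₁) (sub_nonneg.2 hs.le) le_rfl) (hγ B hs.nonneg)

/-- ISS of a cascade: `X` and `Z` are driven by `ξ`, and `ζ` is driven by `Z` and by the stack of
`X` and `ξ`. The joint output `Y` of `Z` and `ζ` is then driven by `ξ`. -/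
theorem HasKLEstimate.cascade {I : Type*} {lo hi : I → ℝ} {σ₁ σ X Z ζ Xh ξ Y : I → ℝ → ℝ}
    {gX g γ γ' Γ : ℝ → ℝ} (hσ₁ : ∀ i t, 0 ≤ σ₁ i t) (hσ₁σ : ∀ i t, σ₁ i t ≤ σ i t)
    (hζ : ∀ i t, 0 ≤ ζ i t) (hζσ : ∀ i t, ζ i t ≤ σ i t)
    (hXh : ∀ i t, Xh i t ≤ 2 * max (X i t) (ξ i t))
    (hY : ∀ i t, Y i t ≤ 2 * max (Z i t) (ζ i t))
    (hgX : ∀ s, 0 ≤ s → gX s ≤ s) (hg : IsClassKInf g) (hγ : IsClassKInf γ)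
    (hγ' : IsClassKInf γ') (hΓ : IsClassKInf Γ)
    (hΓle : ∀ b, 0 ≤ b → 2 * max (γ' (2 * b)) (max (g b) (γ (g b))) ≤ Γ b)
    (hX : HasKLEstimate lo hi σ₁ X ξ gX) (hZ : HasKLEstimate lo hi σ₁ Z ξ g)
    (hζest : ∃ β, IsClassKL β ∧ ∀ i t₁ t B₁ B₂, BoundedOnSegment lo hi Z i t₁ t B₁ →
      BoundedOnSegment lo hi Xh i t₁ t B₂ →
      ζ i t ≤ max (β (ζ i t₁) (t - t₁)) (max (γ B₁) (γ' B₂))) :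
    HasKLEstimate lo hi σ Y ξ Γ := by
  obtain ⟨βX, hβX, hX⟩ := hX
  obtain ⟨βZ, hβZ, hZ⟩ := hZ
  obtain ⟨βζ, hβζ, hζest⟩ := hζest
  have hσ : ∀ i t, 0 ≤ σ i t := fun i t => (hσ₁ i t).trans (hσ₁σ i t)
  -- On a segment where `X` and `ξ` are within level `b` and `Z` is within `g b`, the bound for `ζ`
  -- holds once its transient is over.
  have keyζ : ∀ i t₁ t B b, BoundedOnSegment lo hi ξ i t₁ t B → B ≤ b →
      (∀ s ∈ Icc t₁ t, X i s ≤ b ∧ Z i s ≤ g b) → βζ (ζ i t₁) (t - t₁) ≤ γ' (2 * b) →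
      ζ i t ≤ max (γ' (2 * b)) (max (g b) (γ (g b))) := by
    intro i t₁ t B b hs hB h1 h2
    have hb : 0 ≤ b := hs.nonneg.trans hB
    refine (hζest i t₁ t (g b) (2 * b) ⟨hs.lo_le, hs.le, hs.le_hi, hg.1.nonneg hb,
      fun s hs' => (h1 s hs').2⟩ ⟨hs.lo_le, hs.le, hs.le_hi, by positivity, fun s hs' => ?_⟩).trans
      ?_
    · exact (hXh i s).trans (mul_le_mul_of_nonneg_left
        (max_le (h1 s hs').1 ((hs.bound s hs').trans hB)) zero_le_two)
    · exact max_le (h2.trans (le_max_left _ _)) (max_le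
        ((le_max_right _ _).trans (le_max_right _ _)) (le_max_left _ _))
  have keyY : ∀ i t b, 0 ≤ b → Z i t ≤ g b → ζ i t ≤ max (γ' (2 * b)) (max (g b) (γ (g b))) →
      Y i t ≤ Γ b := by
    intro i t b hb h1 h2
    refine (hY i t).trans ((mul_le_mul_of_nonneg_left (max_le ?_ h2) zero_le_two).trans (hΓle b hb))
    exact h1.trans ((le_max_left _ _).trans (le_max_right _ _))
  -- Levels that dominate all transients are never exceeded.
  have hinv : ∀ r M, 0 ≤ r → 0 ≤ M → βX r 0 ≤ M → βZ r 0 ≤ g M → βζ r 0 ≤ γ' (2 * M) →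
      ∀ i t₁ t B, BoundedOnSegment lo hi ξ i t₁ t B → σ i t₁ ≤ r → ∀ s ∈ Icc t₁ t,
        X i s ≤ max M B ∧ Z i s ≤ g (max M B) ∧
          ζ i s ≤ max (γ' (2 * max M B)) (max (g (max M B)) (γ (g (max M B)))) := by
    intro r M hr hM h1 h2 h3 i t₁ t B hs hσr
    have hXZ : ∀ s ∈ Icc t₁ t, X i s ≤ max M B ∧ Z i s ≤ g (max M B) := by
      intro s hs'
      have hs1 := hs.restrict le_rfl hs'.1 hs'.2
      have h4 := (hσ₁σ i t₁).trans hσr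
      refine ⟨(hX i t₁ s B hs1).trans (max_le_max ?_ (hgX B hs.nonneg)),
        (hZ i t₁ s B hs1).trans ?_⟩
      · exact (hβX.mono (hσ₁ i t₁) h4 le_rfl (sub_nonneg.2 hs'.1)).trans h1
      · rw [hg.1.map_max hM hs.nonneg]
        exact max_le_max ((hβZ.mono (hσ₁ i t₁) h4 le_rfl (sub_nonneg.2 hs'.1)).trans h2) le_rfl
    intro s hs'
    refine ⟨(hXZ s hs').1, (hXZ s hs').2, ?_⟩
    refine keyζ i t₁ s B _ (hs.restrict le_rfl hs'.1 hs'.2) (le_max_right _ _)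
      (fun u hu => hXZ u ⟨hu.1, hu.2.trans hs'.2⟩) ?_
    exact ((hβζ.mono (hζ i t₁) ((hζσ i t₁).trans hσr) le_rfl (sub_nonneg.2 hs'.1)).trans h3).trans
      (hγ'.1.mono (by positivity) (by linarith [le_max_left M B]))
  have hbounded : ∀ R, ∃ M, 0 < M ∧ βX R 0 ≤ M ∧ βZ R 0 ≤ g M ∧ βζ R 0 ≤ γ' (2 * M) := by
    intro R
    obtain ⟨M₁, hM₁, h1⟩ := hg.exists_ge (βZ R 0)
    obtain ⟨M₂, hM₂, h2⟩ := hγ'.exists_ge (βζ R 0)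
    have h3 := le_max_left M₁ M₂
    have h4 := le_max_right M₁ M₂
    refine ⟨max (βX R 0) (max M₁ M₂), hM₁.trans_le (h3.trans (le_max_right _ _)), le_max_left _ _,
      h1.trans (hg.1.mono hM₁.le (h3.trans (le_max_right _ _))),
      h2.trans (hγ'.1.mono hM₂.le ?_)⟩
    linarith [le_max_right (βX R 0) (max M₁ M₂)]
  refine Settles.hasKLEstimate (N := fun s => s) (Q := fun i t b => Y i t ≤ Γ b) ⟨?_, ?_, ?_⟩ hσ
    IsClassKInf.id hΓ fun i t b _ h => h
  · intro R
    obtain ⟨M, hM, h1, h2, h3⟩ := hbounded (max R 0)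
    refine ⟨M, hM, fun i t₁ t B hs hσR => ?_⟩
    obtain ⟨-, h5, h6⟩ := hinv _ M (le_max_right _ _) hM.le h1 h2 h3 i t₁ t B hs
      (hσR.trans (le_max_left _ _)) t ⟨hs.le, le_rfl⟩
    exact keyY i t _ (hM.le.trans (le_max_left _ _)) h5 h6
  · intro M hM
    obtain ⟨η₁, hη₁, h1⟩ := hβX.exists_small hM
    obtain ⟨η₂, hη₂, h2⟩ := hβZ.exists_small (hg.1.pos hM)
    obtain ⟨η₃, hη₃, h3⟩ := hβζ.exists_small (hγ'.1.pos (mul_pos two_pos hM))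
    have hη : 0 < min η₁ (min η₂ η₃) := lt_min hη₁ (lt_min hη₂ hη₃)
    refine ⟨_, hη, fun i t₁ t B hs hση => ?_⟩
    obtain ⟨-, h5, h6⟩ := hinv _ M hη.le hM.le (h1 _ _ hη.le (min_le_left _ _) le_rfl)
      (h2 _ _ hη.le ((min_le_right _ _).trans (min_le_left _ _)) le_rfl)
      (h3 _ _ hη.le ((min_le_right _ _).trans (min_le_right _ _)) le_rfl) i t₁ t B hs hση t
      ⟨hs.le, le_rfl⟩
    exact keyY i t _ (hM.le.trans (le_max_left _ _)) h5 h6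
  · intro R a ha
    obtain ⟨M, hM, h1, h2, h3⟩ := hbounded (max R 0)
    have hR0 : 0 ≤ max R 0 := le_max_right _ _
    obtain ⟨T₁, hT₁, h4⟩ := hβX.exists_time hR0 ha
    obtain ⟨T₂, hT₂, h5⟩ := hβZ.exists_time hR0 (hg.1.pos ha)
    set b₀ := max M (max R 0) with hb₀
    have hb₀pos : 0 ≤ b₀ := hM.le.trans (le_max_left _ _)
    set R' := max (γ' (2 * b₀)) (max (g b₀) (γ (g b₀))) with hR'
    have hR'0 : 0 ≤ R' := (hγ'.1.nonneg (by positivity)).trans (le_max_left _ _)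
    obtain ⟨T₃, hT₃, h6⟩ := hβζ.exists_time hR'0 (hγ'.1.pos (mul_pos two_pos ha))
    refine ⟨max T₁ T₂ + T₃, fun i t₁ t B hs hσR hBR hT => ?_⟩
    have hT₁₂ : 0 ≤ max T₁ T₂ := hT₁.trans (le_max_left _ _)
    have hσR' := hσR.trans (le_max_left R 0)
    -- The transients of `X` and `Z` are over at `t₂`; that of `ζ`, restarted at `t₂`, is over
    -- at `t`.
    set t₂ := t₁ + max T₁ T₂ with ht₂
    have ht₂mem : t₂ ∈ Icc t₁ t := ⟨by linarith, by linarith⟩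
    have hb : 0 ≤ max a B := ha.le.trans (le_max_left _ _)
    have hXZ : ∀ s ∈ Icc t₂ t, X i s ≤ max a B ∧ Z i s ≤ g (max a B) := by
      intro s hs'
      have hs1 := hs.restrict le_rfl (ht₂mem.1.trans hs'.1) hs'.2
      have h7 := (hσ₁σ i t₁).trans hσR'
      have h8 : max T₁ T₂ ≤ s - t₁ := by linarith [hs'.1]
      refine ⟨(hX i t₁ s B hs1).trans (max_le_max ?_ (hgX B hs.nonneg)),
        (hZ i t₁ s B hs1).trans ?_⟩
      · exact h4 _ _ (hσ₁ i t₁) h7 ((le_max_left _ _).trans h8)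
      · rw [hg.1.map_max ha.le hs.nonneg]
        exact max_le_max (h5 _ _ (hσ₁ i t₁) h7 ((le_max_right _ _).trans h8)) le_rfl
    have hζR' : ζ i t₂ ≤ R' := by
      refine (hinv _ M hR0 hM.le h1 h2 h3 i t₁ t B hs hσR' t₂ ht₂mem).2.2.trans ?_
      have h9 : max M B ≤ b₀ := max_le_max le_rfl (hBR.trans (le_max_left _ _))
      have h10 : 0 ≤ max M B := hM.le.trans (le_max_left _ _)
      have h11 := hg.1.mono h10 h9
      exact max_le_max (hγ'.1.mono (by positivity) (by linarith))
        (max_le_max h11 (hγ.1.mono (hg.1.nonneg h10) h11))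
    refine keyY i t _ hb (hXZ t ⟨ht₂mem.2, le_rfl⟩).2
      (keyζ i t₂ t B _ (hs.restrict ht₂mem.1 ht₂mem.2 le_rfl) (le_max_right _ _) hXZ ?_)
    exact (h6 _ _ (hζ i t₂) hζR' (by linarith)).trans
      (hγ'.1.mono (by positivity) (by linarith [le_max_left a B]))

/-! ### The small-gain argument -/

/-- The nonlinear small-gain theorem in the form used for one step of the recursion. The outputs
`Y` and `X` are driven by `ξ` with gains `Γ` and the identity, and `ξ` satisfies a dissipation
estimate: while `X` and `Y` are within level `b` and `|u| ≤ B`, the quantity `ξ²` decreases at a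
positive rate `C m` as long as `ξ ≥ m`, for every `m ≥ max (χ b) (N B)`. As the loop gain `χ` is
below the identity, the loop settles with the gain `N` of the input alone. -/
theorem Settles.small_gain {I : Type*} {lo hi : I → ℝ} {σ X Y ξ u : I → ℝ → ℝ}
    {Γ χ N C : ℝ → ℝ} (hξ : ∀ i t, 0 ≤ ξ i t) (hξσ : ∀ i t, ξ i t ≤ σ i t)
    (hσle : ∀ i t, σ i t ≤ Y i t + X i t + ξ i t)
    (hξc : ∀ i, ContinuousOn (ξ i) (Icc (lo i) (hi i)))
    (hΓ : IsClassKInf Γ) (hN : IsClassKInf N) (hχc : ContinuousOn χ (Ici 0))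
    (hχm : MonotoneOn χ (Ici 0)) (hχ : ∀ s, 0 < s → χ s < s)
    (hCm : MonotoneOn C (Ici 0)) (hC : ∀ s, 0 < s → 0 < C s)
    (hY : HasKLEstimate lo hi σ Y ξ Γ) (hX : HasKLEstimate lo hi σ X ξ (fun s => s))
    (hL : ∀ i t₁ t B b m, BoundedOnSegment lo hi u i t₁ t B → 0 ≤ b →
      (∀ s ∈ Icc t₁ t, X i s ≤ b ∧ Y i s ≤ Γ b) → 0 < m → χ b ≤ m → N B ≤ m →
      ξ i t ^ 2 ≤ max (m ^ 2) (ξ i t₁ ^ 2 - C m * (t - t₁))) :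
    Settles lo hi σ u N (fun i t b => ξ i t ≤ b ∧ X i t ≤ b ∧ Y i t ≤ Γ b) := by
  obtain ⟨βX, hβX, hX⟩ := hX
  obtain ⟨βY, hβY, hY⟩ := hY
  have hσ : ∀ i t, 0 ≤ σ i t := fun i t => (hξ i t).trans (hξσ i t)
  have hχ' : ∀ s, 0 ≤ s → χ s ≤ s := by
    intro s hs
    refine le_of_forall_gt_imp_ge_of_dense fun a ha => ?_
    exact (hχm hs (hs.trans ha.le) ha.le).trans (hχ a (hs.trans_lt ha)).le
  -- Levels that dominate all transients are never exceeded: at a maximum of `ξ` above the level,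
  -- the loop gain would make `ξ` smaller than its own maximum.
  have hinv : ∀ r M, 0 ≤ r → 0 < M → r ≤ M → βX r 0 ≤ M → βY r 0 ≤ Γ M →
      ∀ i t₁ t B, BoundedOnSegment lo hi u i t₁ t B → σ i t₁ ≤ r → ∀ s ∈ Icc t₁ t,
        ξ i s ≤ max M (N B) ∧ X i s ≤ max M (N B) ∧ Y i s ≤ Γ (max M (N B)) := by
    intro r M hr hM hrM h1 h2 i t₁ t B hs hσr
    have hXY : ∀ s ∈ Icc t₁ t, ∀ a, M ≤ a → (∀ τ ∈ Icc t₁ s, ξ i τ ≤ a) →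
        X i s ≤ a ∧ Y i s ≤ Γ a := by
      intro s hs' a ha hξa
      have hs1 : BoundedOnSegment lo hi ξ i t₁ s a :=
        ⟨hs.lo_le, hs'.1, hs'.2.trans hs.le_hi, hM.le.trans ha, hξa⟩
      refine ⟨(hX i t₁ s a hs1).trans (max_le ?_ le_rfl),
        (hY i t₁ s a hs1).trans (max_le ?_ le_rfl)⟩
      · exact ((hβX.mono (hσ i t₁) hσr le_rfl (sub_nonneg.2 hs'.1)).trans h1).trans ha
      · exact ((hβY.mono (hσ i t₁) hσr le_rfl (sub_nonneg.2 hs'.1)).trans h2).trans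
          (hΓ.1.mono hM.le ha)
    have hξb : ∀ s ∈ Icc t₁ t, ξ i s ≤ max M (N B) := by
      obtain ⟨τ, hτ, hmax⟩ := isCompact_Icc.exists_isMaxOn (nonempty_Icc.2 hs.le)
        ((hξc i).mono (Icc_subset_Icc hs.lo_le hs.le_hi))
      suffices h : ξ i τ ≤ max M (N B) from fun s hs' => (hmax hs').trans h
      by_contra! hlt
      have hM' := (le_max_left M (N B)).trans_lt hlt
      have ha : 0 < ξ i τ := hM.trans hM'
      have h3 := hL i t₁ τ B (ξ i τ) (max (χ (ξ i τ)) (max M (N B)))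
        (hs.restrict le_rfl hτ.1 hτ.2) ha.le
        (fun s hs' => hXY s ⟨hs'.1, hs'.2.trans hτ.2⟩ _ hM'.le
          fun τ' hτ' => hmax ⟨hτ'.1, hτ'.2.trans (hs'.2.trans hτ.2)⟩)
        (hM.trans_le ((le_max_left _ _).trans (le_max_right _ _))) (le_max_left _ _)
        ((le_max_right _ _).trans (le_max_right _ _))
      have h4 : max (χ (ξ i τ)) (max M (N B)) < ξ i τ := max_lt (hχ _ ha) hlt
      have h5 : 0 < max (χ (ξ i τ)) (max M (N B)) :=
        hM.trans_le ((le_max_left _ _).trans (le_max_right _ _))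
      have h6 : ξ i t₁ ≤ max (χ (ξ i τ)) (max M (N B)) :=
        ((hξσ i t₁).trans (hσr.trans hrM)).trans ((le_max_left _ _).trans (le_max_right _ _))
      have h7 := pow_le_pow_left₀ (hξ i t₁) h6 2
      have h8 := mul_nonneg (hC _ h5).le (sub_nonneg.2 hτ.1)
      rcases le_max_iff.1 h3 with h9 | h9 <;> nlinarith
    intro s hs'
    exact ⟨hξb s hs', hXY s hs' _ (le_max_left _ _)
      fun τ hτ => hξb τ ⟨hτ.1, hτ.2.trans hs'.2⟩⟩
  have hbounded : ∀ R, ∃ M, 0 < M ∧ max R 0 ≤ M ∧ βX (max R 0) 0 ≤ M ∧ βY (max R 0) 0 ≤ Γ M := by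
    intro R
    obtain ⟨M, hM, h1⟩ := hΓ.exists_ge (βY (max R 0) 0)
    exact ⟨max M (max (max R 0) (βX (max R 0) 0)), hM.trans_le (le_max_left _ _),
      (le_max_left _ _).trans (le_max_right _ _), (le_max_right _ _).trans (le_max_right _ _),
      h1.trans (hΓ.1.mono hM.le (le_max_left _ _))⟩
  refine ⟨?_, ?_, ?_⟩
  · intro R
    obtain ⟨M, hM, h1, h2, h3⟩ := hbounded R
    exact ⟨M, hM, fun i t₁ t B hs hσR => hinv _ M (le_max_right _ _) hM h1 h2 h3 i t₁ t B hs
      (hσR.trans (le_max_left _ _)) t ⟨hs.le, le_rfl⟩⟩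
  · intro M hM
    obtain ⟨η₁, hη₁, h1⟩ := hβX.exists_small hM
    obtain ⟨η₂, hη₂, h2⟩ := hβY.exists_small (hΓ.1.pos hM)
    have hη : 0 < min M (min η₁ η₂) := lt_min hM (lt_min hη₁ hη₂)
    exact ⟨_, hη, fun i t₁ t B hs hση => hinv _ M hη.le hM (min_le_left _ _)
      (h1 _ _ hη.le ((min_le_right _ _).trans (min_le_left _ _)) le_rfl)
      (h2 _ _ hη.le ((min_le_right _ _).trans (min_le_right _ _)) le_rfl) i t₁ t B hs hση t
      ⟨hs.le, le_rfl⟩⟩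
  · intro R
    obtain ⟨M, hM, h1, h2, h3⟩ := hbounded R
    set b₀ := max M (N (max R 0)) with hb₀
    have hb₀pos : 0 < b₀ := hM.trans_le (le_max_left _ _)
    set R' := Γ b₀ + b₀ + b₀ with hR'
    have hR'0 : 0 ≤ R' := by have := hΓ.1.nonneg hb₀pos.le; positivity
    have hall : ∀ i t₁ t B, BoundedOnSegment lo hi u i t₁ t B → σ i t₁ ≤ R → B ≤ R →
        ∀ s ∈ Icc t₁ t, ξ i s ≤ b₀ ∧ σ i s ≤ R' := by
      intro i t₁ t B hs hσR hBR s hs'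
      obtain ⟨h4, h5, h6⟩ := hinv _ M (le_max_right _ _) hM h1 h2 h3 i t₁ t B hs
        (hσR.trans (le_max_left _ _)) s hs'
      have h7 : max M (N B) ≤ b₀ :=
        max_le_max le_rfl (hN.1.mono hs.nonneg (hBR.trans (le_max_left _ _)))
      have h8 := hΓ.1.mono (hM.le.trans (le_max_left _ _)) h7
      exact ⟨h4.trans h7, (hσle i s).trans (by linarith)⟩
    -- `P a`: the level `max a (N B)` is reached by `ξ` in a uniform time.
    let P : ℝ → Prop := fun a => ∃ T, 0 ≤ T ∧ ∀ i t₁ t B, BoundedOnSegment lo hi u i t₁ t B →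
      σ i t₁ ≤ R → B ≤ R → T ≤ t - t₁ → ξ i t ≤ max a (N B)
    have hfull : ∀ a, 0 < a → P a → ∃ T, 0 ≤ T ∧ ∀ i t₁ t B, BoundedOnSegment lo hi u i t₁ t B →
        σ i t₁ ≤ R → B ≤ R → T ≤ t - t₁ →
        ξ i t ≤ max a (N B) ∧ X i t ≤ max a (N B) ∧ Y i t ≤ Γ (max a (N B)) := by
      rintro a ha ⟨T, hT, hP⟩
      obtain ⟨T₁, hT₁, h4⟩ := hβX.exists_time hR'0 ha
      obtain ⟨T₂, hT₂, h5⟩ := hβY.exists_time hR'0 (hΓ.1.pos ha)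
      refine ⟨T + max T₁ T₂, add_nonneg hT (hT₁.trans (le_max_left _ _)),
        fun i t₁ t B hs hσR hBR ht => ?_⟩
      have h6 : 0 ≤ max T₁ T₂ := hT₁.trans (le_max_left _ _)
      have hmem : t₁ + T ∈ Icc t₁ t := ⟨by linarith, by linarith⟩
      have hs1 : BoundedOnSegment lo hi ξ i (t₁ + T) t (max a (N B)) :=
        ⟨hs.lo_le.trans hmem.1, hmem.2, hs.le_hi, ha.le.trans (le_max_left _ _), fun s hs' =>
          hP i t₁ s B (hs.restrict le_rfl (hmem.1.trans hs'.1) hs'.2) hσR hBR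
            (by linarith [hs'.1])⟩
      have h7 := (hall i t₁ t B hs hσR hBR _ hmem).2
      refine ⟨hs1.bound t ⟨hmem.2, le_rfl⟩, (hX i _ t _ hs1).trans (max_le ?_ le_rfl),
        (hY i _ t _ hs1).trans (max_le ?_ le_rfl)⟩
      · exact (h4 _ _ (hσ _ _) h7 (by linarith [le_max_left T₁ T₂])).trans (le_max_left _ _)
      · exact (h5 _ _ (hσ _ _) h7 (by linarith [le_max_right T₁ T₂])).trans
          (hΓ.1.mono ha.le (le_max_left _ _))
    -- One pass around the loop improves the level `a` to any positive `a' ≥ χ a`.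
    have hstep : ∀ a a', 0 < a → 0 < a' → χ a ≤ a' → P a → P a' := by
      intro a a' ha ha' haa' hPa
      obtain ⟨T, hT, hfa⟩ := hfull a ha hPa
      have hCa' := hC a' ha'
      refine ⟨T + b₀ ^ 2 / C a', by positivity, fun i t₁ t B hs hσR hBR ht => ?_⟩
      have hdiv : 0 ≤ b₀ ^ 2 / C a' := by positivity
      have hmem : t₁ + T ∈ Icc t₁ t := ⟨by linarith, by linarith⟩
      have hNB := hN.1.nonneg hs.nonneg
      have hm : 0 < max a' (N B) := ha'.trans_le (le_max_left _ _)
      have h4 := hL i (t₁ + T) t B (max a (N B)) (max a' (N B))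
        (hs.restrict hmem.1 hmem.2 le_rfl) (ha.le.trans (le_max_left _ _))
        (fun s hs' => (hfa i t₁ s B (hs.restrict le_rfl (hmem.1.trans hs'.1) hs'.2) hσR hBR
          (by linarith [hs'.1])).2) hm
        (by
          rw [hχm.map_max ha.le hNB]
          exact max_le_max haa' (hχ' _ hNB))
        (le_max_right _ _)
      have h5 := pow_le_pow_left₀ (hξ i (t₁ + T)) (hall i t₁ t B hs hσR hBR _ hmem).1 2
      have h6 : C a' ≤ C (max a' (N B)) := hCm ha'.le hm.le (le_max_left _ _)
      have h7 : b₀ ^ 2 / C a' ≤ t - (t₁ + T) := by linarith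
      have h8 : b₀ ^ 2 ≤ C (max a' (N B)) * (t - (t₁ + T)) := by
        rw [div_le_iff₀ hCa'] at h7
        nlinarith [mul_le_mul_of_nonneg_right h6 (hdiv.trans (by linarith : _ ≤ t - (t₁ + T)))]
      have h9 : ξ i t ^ 2 ≤ max a' (N B) ^ 2 :=
        h4.trans (max_le le_rfl (by nlinarith))
      exact le_of_sq_le_sq h9 hm.le
    have hPmono : ∀ a a', a ≤ a' → P a → P a' := by
      rintro a a' haa' ⟨T, hT, h⟩
      exact ⟨T, hT, fun i t₁ t B hs h4 h5 h6 =>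
        (h i t₁ t B hs h4 h5 h6).trans (max_le_max haa' le_rfl)⟩
    have hPb₀ : P b₀ := ⟨0, le_rfl, fun i t₁ t B hs h4 h5 _ =>
      (hall i t₁ t B hs h4 h5 t ⟨hs.le, le_rfl⟩).1.trans (le_max_left _ _)⟩
    -- The infimum of the attained levels is zero, since near a positive infimum the continuous
    -- loop gain `χ` would lead below it.
    have hPall : ∀ a, 0 < a → P a := by
      intro a₀ ha₀
      by_contra hna
      let A : Set ℝ := {a | P a}
      have hlow : ∀ a ∈ A, a₀ ≤ a := fun a ha => le_of_not_gt fun hlt => hna (hPmono a a₀ hlt.le ha)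
      have hbdd : BddBelow A := ⟨a₀, hlow⟩
      have hpos : 0 < sInf A := ha₀.trans_le (le_csInf ⟨b₀, hPb₀⟩ hlow)
      have hcont : ContinuousAt χ (sInf A) := hχc.continuousAt (Ici_mem_nhds hpos)
      have hev : ∀ᶠ x in 𝓝[>] (sInf A), χ x < sInf A :=
        (hcont.eventually_lt_const (hχ _ hpos)).filter_mono nhdsWithin_le_nhds
      obtain ⟨a, hχa, ha⟩ := (hev.and self_mem_nhdsWithin).exists
      have ha : sInf A < a := ha
      obtain ⟨a₁, ha₁, ha₁a⟩ := exists_lt_of_csInf_lt ⟨b₀, hPb₀⟩ ha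
      have hmem : max (χ a) (sInf A / 2) ∈ A :=
        hstep a _ (hpos.trans ha) ((half_pos hpos).trans_le (le_max_right _ _)) (le_max_left _ _)
          (hPmono a₁ a ha₁a.le ha₁)
      have h10 := csInf_le hbdd hmem
      exact absurd h10 (not_le.2 (max_lt hχa (half_lt_self hpos)))
    intro a ha
    obtain ⟨T, -, hT⟩ := hfull a ha (hPall a ha)
    exact ⟨T, hT⟩

/-! ### Differential inequalities with finitely many exceptional times -/

theorem le_of_hasDerivAt_nonpos_off_finite {f : ℝ → ℝ} {S : Set ℝ} (hS : S.Finite) :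
    ∀ {a b : ℝ}, a ≤ b → ContinuousOn f (Icc a b) →
      (∀ s ∈ Ioo a b \ S, ∃ d, HasDerivAt f d s ∧ d ≤ 0) → f b ≤ f a := by
  induction S, hS using Set.Finite.induction_on with
  | empty =>
    intro a b hab hc hd
    refine antitoneOn_of_deriv_nonpos (convex_Icc a b) hc ?_ ?_ (left_mem_Icc.2 hab)
      (right_mem_Icc.2 hab) hab
    · rw [interior_Icc]
      intro s hs
      obtain ⟨d, hd, -⟩ := hd s ⟨hs, notMem_empty s⟩
      exact hd.differentiableAt.differentiableWithinAt
    · rw [interior_Icc]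
      intro s hs
      obtain ⟨d, hd, hd0⟩ := hd s ⟨hs, notMem_empty s⟩
      rwa [hd.deriv]
  | @insert p S _ _ ih =>
    intro a b hab hc hd
    by_cases hp : p ∈ Ioo a b
    · have h1 := ih hp.1.le (hc.mono (Icc_subset_Icc_right hp.2.le)) fun s hs =>
        hd s ⟨⟨hs.1.1, hs.1.2.trans hp.2⟩, by
          rintro (rfl | h)
          exacts [lt_irrefl _ hs.1.2, hs.2 h]⟩
      have h2 := ih hp.2.le (hc.mono (Icc_subset_Icc_left hp.1.le)) fun s hs =>
        hd s ⟨⟨hp.1.trans hs.1.1, hs.1.2⟩, by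
          rintro (rfl | h)
          exacts [lt_irrefl _ hs.1.1, hs.2 h]⟩
      exact h2.trans h1
    · exact ih hab hc fun s hs => hd s ⟨hs.1, by
        rintro (rfl | h)
        exacts [hp hs.1, hs.2 h]⟩

/-- A function that decreases at rate at least `c` while it is at least `μ` cannot end above `μ`
unless it has decreased at that rate all the time. -/
theorem le_max_of_hasDerivAt_off_finite {V : ℝ → ℝ} {S : Set ℝ} (hS : S.Finite) {t₁ t₂ μ c : ℝ}
    (ht : t₁ ≤ t₂)
    (hc0 : 0 ≤ c) (hc : ContinuousOn V (Icc t₁ t₂))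
    (hd : ∀ s ∈ Ioo t₁ t₂ \ S, ∃ d, HasDerivAt V d s ∧ (μ ≤ V s → d ≤ -c)) :
    V t₂ ≤ max μ (V t₁ - c * (t₂ - t₁)) := by
  by_contra! hlt
  obtain ⟨hμ, hV⟩ := max_lt_iff.1 hlt
  have key : ∀ a ∈ Icc t₁ t₂, (∀ s ∈ Ioc a t₂, μ ≤ V s) → V t₂ ≤ V a - c * (t₂ - a) := by
    intro a ha hVa
    have h := le_of_hasDerivAt_nonpos_off_finite (f := fun s => V s + c * s) hS ha.2
      ((hc.mono (Icc_subset_Icc_left ha.1)).add (by fun_prop)) fun s hs => by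
        obtain ⟨d, h1, h2⟩ := hd s ⟨⟨ha.1.trans_lt hs.1.1, hs.1.2⟩, hs.2⟩
        refine ⟨d + c * 1, h1.add ((hasDerivAt_id s).const_mul c), ?_⟩
        linarith [h2 (hVa s ⟨hs.1.1, hs.1.2.le⟩)]
    linarith
  -- the last time in `[t₁, t₂]` at which `V ≤ μ`, if there is one
  by_cases hne : (Icc t₁ t₂ ∩ V ⁻¹' Iic μ).Nonempty
  · have hcomp : IsCompact (Icc t₁ t₂ ∩ V ⁻¹' Iic μ) :=
      isCompact_Icc.of_isClosed_subset (hc.preimage_isClosed_of_isClosed isClosed_Icc isClosed_Iic)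
        inter_subset_left
    obtain ⟨a, ⟨ha, hVa⟩, hmax⟩ := hcomp.exists_isGreatest hne
    have hVa : V a ≤ μ := hVa
    have hat : a < t₂ := lt_of_le_of_ne ha.2 fun h => by subst h; linarith
    have habove : ∀ s ∈ Ioc a t₂, μ ≤ V s := fun s hs => le_of_not_gt fun h =>
      absurd (hmax ⟨⟨ha.1.trans hs.1.le, hs.2⟩, h.le⟩) (not_le.2 hs.1)
    have := key a ha habove
    nlinarith [mul_nonneg hc0 (sub_nonneg.2 ha.2)]
  · have := key t₁ (left_mem_Icc.2 ht) fun s hs => le_of_not_gt fun h =>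
      hne ⟨s, ⟨hs.1.le, hs.2⟩, h.le⟩
    linarith

/-! ### Loop gains -/

/-- The loop gain `χ = ρ⁻¹ ∘ F`, with `F` the running maximum of `k max {f ∘ Γ, μ}`, is below the
identity if `k f(Γ(s))` and `k μ(s)` are below `ρ(s)`. The functions `f` and `μ` need not be
monotone. -/
theorem exists_loop_gain {ρ Γ f μ : ℝ → ℝ} {k : ℝ} (hρ : IsClassKInf ρ) (hΓ : IsClassKInf Γ)
    (hf : ContinuousOn f (Ici 0)) (hμ : ContinuousOn μ (Ici 0)) (hf0 : f 0 = 0) (hμ0 : μ 0 = 0)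
    (hfρ : ∀ s, 0 < s → k * f (Γ s) < ρ s) (hμρ : ∀ s, 0 < s → k * μ s < ρ s) :
    ∃ χ : ℝ → ℝ, ContinuousOn χ (Ici 0) ∧ MonotoneOn χ (Ici 0) ∧ (∀ s, 0 < s → χ s < s) ∧
      ∀ b m, 0 ≤ b → 0 ≤ m → χ b ≤ m →
        (∀ y, 0 ≤ y → y ≤ Γ b → k * f y ≤ ρ m) ∧ (∀ x, 0 ≤ x → x ≤ b → k * μ x ≤ ρ m) := by
  let h : ℝ → ℝ := fun s => max (k * f (Γ s)) (k * μ s)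
  have h0 : h 0 = 0 := by simp [h, hΓ.1.2.2, hf0, hμ0]
  have hhρ : ∀ s, 0 < s → h s < ρ s := fun s hs => max_lt (hfρ s hs) (hμρ s hs)
  have hc : ContinuousOn h (Ici 0) :=
    (continuousOn_const.mul (hf.comp hΓ.1.1 fun s hs => hΓ.1.nonneg hs)).sup
      (continuousOn_const.mul hμ)
  obtain ⟨F, hFc, hFm, hhF, hFh⟩ := exists_continuous_monotone_envelope hc
  have hF0 : ∀ b, 0 ≤ b → 0 ≤ F b := fun b hb => h0 ▸ hhF 0 b le_rfl hb
  have hFρ : ∀ s, 0 < s → F s < ρ s := by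
    intro s hs
    obtain ⟨s', hs', hss, h1⟩ := hFh s hs.le
    rw [h1]
    rcases hs'.eq_or_lt with rfl | hs'
    · rw [h0]
      exact hρ.1.pos hs
    · exact (hhρ s' hs').trans_le (hρ.1.mono hs'.le hss)
  refine ⟨fun s => Function.invFunOn ρ (Ici 0) (F s), hρ.invFunOn.1.1.comp hFc fun b hb => hF0 b hb,
    fun a ha b hb hab => hρ.invFunOn.1.mono (hF0 a ha) (hFm ha hb hab),
    fun s hs => (hρ.invFunOn_lt_iff hs.le (hF0 s hs.le)).2 (hFρ s hs), fun b m hb hm hχ => ?_⟩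
  have hFm : F b ≤ ρ m := by
    by_contra! hlt
    exact absurd hχ (not_le.2 ((hρ.lt_invFunOn_iff hm (hF0 b hb)).2 hlt))
  refine ⟨fun y hy hyb => ?_, fun x hx hxb => ?_⟩
  · obtain ⟨s, hs, rfl⟩ := hΓ.surjOn hy
    have hsb : s ≤ b := (hΓ.1.2.1.le_iff_le hs hb).1 hyb
    exact ((le_max_left _ _).trans (hhF s b hs hsb)).trans hFm
  · exact ((le_max_right _ _).trans (hhF x b hx hxb)).trans hFm

/-! ### Stacked vectors and signals -/

theorem norm_zHead_succ_sq {n : ℕ → ℕ} (k : ℕ) (z : ∀ i : ℕ, EuclideanSpace ℝ (Fin (n i))) :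
    ‖zHead (k + 1) z‖ ^ 2 = ‖zHead k z‖ ^ 2 + ‖z k‖ ^ 2 := by
  simp [zHead, PiLp.norm_sq_eq_of_L2, Fin.sum_univ_castSucc]

theorem norm_xHead_succ_sq (k : ℕ) (x : ℕ → ℝ) :
    ‖xHead (k + 1) x‖ ^ 2 = ‖xHead k x‖ ^ 2 + |x k| ^ 2 := by
  simp [xHead, EuclideanSpace.norm_sq_eq, Fin.sum_univ_castSucc]

theorem norm_zHead_le_succ {n : ℕ → ℕ} (k : ℕ) (z : ∀ i : ℕ, EuclideanSpace ℝ (Fin (n i))) :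
    ‖zHead k z‖ ≤ ‖zHead (k + 1) z‖ :=
  le_of_sq_le_sq (by rw [norm_zHead_succ_sq]; linarith [sq_nonneg ‖z k‖]) (norm_nonneg _)

theorem norm_le_norm_zHead_succ {n : ℕ → ℕ} (k : ℕ)
    (z : ∀ i : ℕ, EuclideanSpace ℝ (Fin (n i))) : ‖z k‖ ≤ ‖zHead (k + 1) z‖ :=
  le_of_sq_le_sq (by rw [norm_zHead_succ_sq]; linarith [sq_nonneg ‖zHead k z‖]) (norm_nonneg _)

theorem norm_xHead_le_succ (k : ℕ) (x : ℕ → ℝ) : ‖xHead k x‖ ≤ ‖xHead (k + 1) x‖ :=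
  le_of_sq_le_sq (by rw [norm_xHead_succ_sq]; linarith [sq_nonneg |x k|]) (norm_nonneg _)

theorem abs_le_norm_xHead_succ (k : ℕ) (x : ℕ → ℝ) : |x k| ≤ ‖xHead (k + 1) x‖ :=
  le_of_sq_le_sq (by rw [norm_xHead_succ_sq]; linarith [sq_nonneg ‖xHead k x‖]) (norm_nonneg _)

theorem norm_zHead_zero {n : ℕ → ℕ} (z : ∀ i : ℕ, EuclideanSpace ℝ (Fin (n i))) :
    ‖zHead 0 z‖ = 0 := by
  rw [← sq_eq_zero_iff]
  simp [zHead, PiLp.norm_sq_eq_of_L2]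

theorem norm_xHead_zero (x : ℕ → ℝ) : ‖xHead 0 x‖ = 0 := by
  rw [← sq_eq_zero_iff]
  simp [xHead, EuclideanSpace.norm_sq_eq]

theorem norm_zHead_one {n : ℕ → ℕ} (z : ∀ i : ℕ, EuclideanSpace ℝ (Fin (n i))) :
    ‖zHead 1 z‖ = ‖z 0‖ := by
  have h := norm_zHead_succ_sq 0 z
  rw [norm_zHead_zero] at h
  exact (pow_left_inj₀ (norm_nonneg _) (norm_nonneg _) two_ne_zero).1 (by linarith)

theorem norm_xHead_one (x : ℕ → ℝ) : ‖xHead 1 x‖ = |x 0| := by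
  have h := norm_xHead_succ_sq 0 x
  rw [norm_xHead_zero] at h
  exact (pow_left_inj₀ (norm_nonneg _) (abs_nonneg _) two_ne_zero).1 (by linarith)

theorem le_sqrt_two_mul_max {r a b : ℝ} (ha : 0 ≤ a) (hb : 0 ≤ b)
    (h : r ^ 2 = a ^ 2 + b ^ 2) : r ≤ √2 * max a b := by
  refine le_of_sq_le_sq ?_ (mul_nonneg (Real.sqrt_nonneg 2) (ha.trans (le_max_left _ _)))
  rw [mul_pow, Real.sq_sqrt zero_le_two, h]
  have h1 := pow_le_pow_left₀ ha (le_max_left a b) 2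
  have h2 := pow_le_pow_left₀ hb (le_max_right a b) 2
  linarith

theorem sqrt_two_le_two : √2 ≤ (2 : ℝ) := by
  rw [Real.sqrt_le_left zero_le_two]
  norm_num

theorem norm_le_supNorm {E : Type*} [NormedAddCommGroup E] {d : ℝ → E} {t₀ t M : ℝ}
    (hd : ∀ s ∈ Icc t₀ t, ‖d s‖ ≤ M) {s : ℝ} (hs : s ∈ Icc t₀ t) : ‖d s‖ ≤ supNorm d t₀ t :=
  le_csSup ⟨M, by rintro _ ⟨s, hs, rfl⟩; exact hd s hs⟩ ⟨s, hs, rfl⟩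

theorem supNorm_le {E : Type*} [NormedAddCommGroup E] {d : ℝ → E} {t₀ t M : ℝ} (ht : t₀ ≤ t)
    (hd : ∀ s ∈ Icc t₀ t, ‖d s‖ ≤ M) : supNorm d t₀ t ≤ M :=
  csSup_le ⟨_, t₀, left_mem_Icc.2 ht, rfl⟩ (by rintro _ ⟨s, hs, rfl⟩; exact hd s hs)

theorem supNorm_nonneg {E : Type*} [NormedAddCommGroup E] (d : ℝ → E) (t₀ t : ℝ) :
    0 ≤ supNorm d t₀ t :=
  Real.sSup_nonneg (by rintro _ ⟨s, -, rfl⟩; exact norm_nonneg _)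

theorem ContinuousOn.isPiecewiseContBdd {E : Type*} [NormedAddCommGroup E] {d : ℝ → E} {t₀ T : ℝ}
    (h : ContinuousOn d (Icc t₀ T)) : IsPiecewiseContBdd d t₀ T :=
  ⟨⟨∅, finite_empty, by simpa using h⟩, isCompact_Icc.exists_bound_of_continuousOn h⟩

theorem IsSolution.mono {E : Type*} [NormedAddCommGroup E] [NormedSpace ℝ E] {y v : ℝ → E}
    {t₀ T t₁ t : ℝ} (h : IsSolution y v t₀ T) (h₁ : t₀ ≤ t₁) (h₂ : t ≤ T) :
    IsSolution y v t₁ t := by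
  obtain ⟨hc, S, hS, hd⟩ := h
  exact ⟨hc.mono (Icc_subset_Icc h₁ h₂), S, hS,
    fun s hs => hd s ⟨Ioo_subset_Ioo h₁ h₂ hs.1, hs.2⟩⟩

theorem continuousOn_zHead {n : ℕ → ℕ} {k : ℕ} {z : ℝ → ∀ i : ℕ, EuclideanSpace ℝ (Fin (n i))}
    {s : Set ℝ} (h : ∀ i, i < k → ContinuousOn (fun t => z t i) s) :
    ContinuousOn (fun t => zHead k (z t)) s :=
  (PiLp.continuous_toLp 2 _).comp_continuousOn (continuousOn_pi.2 fun i => h i i.2)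

theorem continuousOn_xHead {k : ℕ} {x : ℝ → ℕ → ℝ} {s : Set ℝ}
    (h : ∀ i, i < k → ContinuousOn (fun t => x t i) s) :
    ContinuousOn (fun t => xHead k (x t)) s :=
  (PiLp.continuous_toLp 2 _).comp_continuousOn (continuousOn_pi.2 fun i => h i i.2)

/-! ### The transformed equations -/

theorem xOrig_xBar (θ : ℕ → ℝ → ℝ) (x : ℕ → ℝ) : xOrig θ (xBar θ x) = x := by
  funext j
  cases j <;> simp [xOrig, xBar]

theorem Design.Regular.θ_eq {D : Design} {ℓ : ℕ} (h : D.Regular ℓ) (b : ℕ → ℝ) {j : ℕ}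
    (hj : j < ℓ) (x : ℝ) :
    D.θ b j x = -(D.cBar j + 1 / 4 * b j ^ 2 + D.m j x + D.ψ j x) * x / b j := by
  have : D.ψ j |x| = D.ψ j x := by
    rcases abs_choice x with hx | hx <;> rw [hx]
    exact h.ψ_even j hj x
  rw [Design.θ, this]

theorem Design.Regular.differentiable_θ {D : Design} {ℓ : ℕ} (h : D.Regular ℓ) (b : ℕ → ℝ) {j : ℕ}
    (hj : j < ℓ) : Differentiable ℝ (D.θ b j) := by
  have h1 : Differentiable ℝ (D.m j) := (h.contDiff_m j hj).differentiable one_ne_zero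
  have h2 : Differentiable ℝ (D.ψ j) := (h.contDiff_ψ j hj).differentiable one_ne_zero
  rw [funext (h.θ_eq b hj)]
  fun_prop

/-- The transformed coordinate `x̄_j` solves `x̄_j' = f̄_j + b_j ϑ_j(x̄_j) + b_j x̄_{j+1}`. -/
theorem LTSystem.isSolution_xBar (P : LTSystem) {θ : ℕ → ℝ → ℝ}
    {w : EuclideanSpace ℝ (Fin P.p)} {z : ℝ → P.ZState} {x : ℝ → ℕ → ℝ} {t₀ T : ℝ} :
    ∀ j, (∀ i, i < j → Differentiable ℝ (θ i)) → (∀ i, i ≤ j → P.SolvesX w i z x t₀ T) →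
      IsSolution (fun t => xBar θ (x t) j)
        (fun t => P.fBar θ j (z t) (xBar θ (x t)) w + P.b j * θ j (xBar θ (x t) j)
          + P.b j * xBar θ (x t) (j + 1)) t₀ T
  | 0, _, hx => by
    obtain ⟨hc, S, hS, hd⟩ := hx 0 le_rfl
    refine ⟨hc, S, hS, fun t ht => ?_⟩
    refine (hd t ht).congr_deriv ?_
    simp only [LTSystem.fBar, xOrig_xBar]
    simp only [xBar]
    ring
  | j + 1, hθ, hx => by
    obtain ⟨hc, S, hS, hd⟩ := hx (j + 1) le_rfl
    obtain ⟨hc', S', hS', hd'⟩ := LTSystem.isSolution_xBar P j (fun i hi => hθ i (by omega))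
      (fun i hi => hx i (by omega))
    have hθj := hθ j (Nat.lt_succ_self j)
    refine ⟨hc.sub (hθj.continuous.comp_continuousOn hc'), S ∪ S', hS.union hS', fun t ht => ?_⟩
    have h1 := hd t ⟨ht.1, fun h => ht.2 (Or.inl h)⟩
    have h2 := hd' t ⟨ht.1, fun h => ht.2 (Or.inr h)⟩
    refine (h1.sub ((hθj _).hasDerivAt.comp t h2)).congr_deriv ?_
    simp only [LTSystem.fBar, xOrig_xBar]
    rw [show x t (j + 1 + 1) = xBar θ (x t) (j + 1 + 1) + θ (j + 1) (xBar θ (x t) (j + 1)) by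
      simp [xBar]]
    ring

theorem Design.ιBar_zero (D : Design) (j : ℕ) : D.ιBar j 0 = 0 := by simp [Design.ιBar]

theorem Design.mBar_zero (D : Design) (j : ℕ) : D.mBar j 0 = 0 := by simp [Design.mBar]

theorem abs_mul_mul_le_add {c y a : ℝ} (hc : 0 < c) :
    |y| * a ≤ c * y ^ 2 + 1 / (4 * c) * a ^ 2 := by
  have h : c * y ^ 2 + 1 / (4 * c) * a ^ 2 - |y| * a = c * (|y| - a / (2 * c)) ^ 2 := by
    rw [← sq_abs y]
    field_simp
    ring
  have := mul_nonneg hc.le (sq_nonneg (|y| - a / (2 * c)))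
  linarith

/-- The dissipation inequality for `x̄_j² / 2`: the controller dominates the three couplings by
completing squares. -/
theorem LTSystem.dissipation {P : LTSystem} {D : Design} (hreg : D.Regular P.ℓ)
    (hdrift : P.DriftBound D) {j : ℕ} (hj : j < P.ℓ) (z : P.ZState) (y : ℕ → ℝ)
    {w : EuclideanSpace ℝ (Fin P.p)} (hw : w ∈ P.W) :
    y j * (P.fBar (D.θ P.b) j z y w + P.b j * D.θ P.b j (y j) + P.b j * y (j + 1)) ≤
      -D.ρ j |y j| + D.ιBar j ‖zHead (j + 1) z‖ + D.mBar j ‖xHead j y‖ + |y (j + 1)| ^ 2 := by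
  have hb := P.b_ne_zero j hj
  have hc := hreg.c_pos j hj
  have hd := mul_le_mul_of_nonneg_left (hdrift j hj z y w hw) (abs_nonneg (y j))
  have h1 : y j * P.fBar (D.θ P.b) j z y w ≤ |y j| * |P.fBar (D.θ P.b) j z y w| := by
    rw [← abs_mul]
    exact le_abs_self _
  have h2 := abs_mul_mul_le_add (y := y j) (a := D.ι j ‖zHead (j + 1) z‖ * ‖zHead (j + 1) z‖) hc
  have h3 : |y j| * (D.mt j ‖xHead j y‖ * ‖xHead j y‖) ≤
      (D.cBar j - D.c j) * y j ^ 2 + D.mBar j ‖xHead j y‖ := by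
    cases j with
    | zero => simp [norm_xHead_zero, Design.cBar, Design.mBar]
    | succ j =>
      have := abs_mul_mul_le_add (y := y (j + 1))
        (a := D.mt (j + 1) ‖xHead (j + 1) y‖ * ‖xHead (j + 1) y‖) hc
      simp only [Design.cBar, Design.mBar]
      linarith
  have h4 : P.b j * D.θ P.b j (y j) =
      -(D.cBar j + 1 / 4 * P.b j ^ 2 + D.m j (y j) + D.ψ j |y j|) * y j := by
    rw [Design.θ]
    field_simp
  have h5 := sq_nonneg (P.b j * y j / 2 - y (j + 1))
  have h6 : |y j| * (D.m j (y j) * |y j|) = D.m j (y j) * (y j * y j) := by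
    rw [mul_left_comm, abs_mul_abs_self]
  rw [h4, Design.ρ, Design.ιBar, sq_abs, sq_abs]
  rw [mul_add, mul_add, h6] at hd
  linarith

theorem Design.Regular.exists_dissipation_rate {D : Design} {ℓ : ℕ} (h : D.Regular ℓ) {j : ℕ}
    (hj : j < ℓ) : 0 < D.k j ∧ ∃ c, 0 < c ∧ ∀ y x u r, (j = 0 → D.mBar j x = 0) → 0 ≤ r →
      D.k j * D.ιBar j y ≤ r → D.k j * D.mBar j x ≤ r → D.k j * u ≤ r →
      -r + D.ιBar j y + D.mBar j x + u ≤ -(c * r) := by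
  rcases Nat.eq_zero_or_pos j with rfl | hj0
  · have hk := h.two_lt_k 0 hj rfl
    have hk0 : 0 < D.k 0 := by linarith
    refine ⟨hk0, 1 - 2 / D.k 0, by rw [sub_pos, div_lt_one hk0]; exact hk, ?_⟩
    intro y x u r hx hr h1 h2 h3
    rw [hx rfl]
    rw [← le_div_iff₀' hk0] at h1 h3
    have : 2 / D.k 0 * r = r / D.k 0 + r / D.k 0 := by ring
    nlinarith
  · have hk := h.three_lt_k j hj hj0
    have hk0 : 0 < D.k j := by linarith
    refine ⟨hk0, 1 - 3 / D.k j, by rw [sub_pos, div_lt_one hk0]; exact hk, ?_⟩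
    intro y x u r hx hr h1 h2 h3
    rw [← le_div_iff₀' hk0] at h1 h2 h3
    have : 3 / D.k j * r = r / D.k j + r / D.k j + r / D.k j := by ring
    nlinarith

/-- While the couplings are dominated by `ρ_j(m)`, the coordinate `x̄_j` decreases at a uniform rate
until it is within `m`. -/
theorem LTSystem.exists_decay {P : LTSystem} {D : Design} (hreg : D.Regular P.ℓ)
    (hdrift : P.DriftBound D) {j : ℕ} (hj : j < P.ℓ) :
    ∃ c, 0 < c ∧ ∀ w ∈ P.W, ∀ (z : ℝ → P.ZState) (x : ℝ → ℕ → ℝ) (t₁ t m : ℝ), t₁ ≤ t → 0 < m →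
      (∀ i, i ≤ j → P.SolvesX w i z x t₁ t) →
      (∀ s ∈ Icc t₁ t, D.k j * D.ιBar j ‖zHead (j + 1) (z s)‖ ≤ D.ρ j m ∧
        D.k j * D.mBar j ‖xHead j (xBar (D.θ P.b) (x s))‖ ≤ D.ρ j m ∧
        D.k j * |xBar (D.θ P.b) (x s) (j + 1)| ^ 2 ≤ D.ρ j m) →
      |xBar (D.θ P.b) (x t) j| ^ 2 ≤
        max (m ^ 2) (|xBar (D.θ P.b) (x t₁) j| ^ 2 - c * D.ρ j m * (t - t₁)) := by
  obtain ⟨hk, c, hc, hrate⟩ := hreg.exists_dissipation_rate hj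
  have hρ := hreg.ρ_classK j hj
  refine ⟨2 * c, by positivity, fun w hw z x t₁ t m ht hm hx hdom => ?_⟩
  obtain ⟨hcont, S, hS, hd⟩ := P.isSolution_xBar (θ := D.θ P.b) j
    (fun i hi => hreg.differentiable_θ P.b (hi.trans hj)) hx
  simp only [sq_abs]
  have hρm := hρ.pos hm
  refine le_max_of_hasDerivAt_off_finite hS ht (by positivity) (hcont.pow 2) fun s hs => ?_
  refine ⟨_, (hd s hs).pow 2, fun hms => ?_⟩
  obtain ⟨h1, h2, h3⟩ := hdom s ⟨hs.1.1.le, hs.1.2.le⟩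
  have h4 := P.dissipation hreg hdrift hj (z s) (xBar (D.θ P.b) (x s)) hw
  have h5 := hrate _ _ _ _ (fun h0 => by subst h0; rw [norm_xHead_zero, D.mBar_zero]) hρm.le h1 h2
    h3
  have h6 : D.ρ j m ≤ D.ρ j |xBar (D.θ P.b) (x s) j| :=
    hρ.mono hm.le (le_of_sq_le_sq (by rw [sq_abs]; exact hms) (abs_nonneg _))
  simp only [Nat.cast_ofNat, Nat.add_one_sub_one, pow_one]
  nlinarith

/-! ### Gains with respect to the transformed input -/

/-- The virtual controller `ϑ_j` is `y` times a continuous function, so `|ϑ_j(y)|` is at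
most a class `K∞` function of `|y|` with finite slope at zero. -/
theorem Design.Regular.exists_θ_bound {D : Design} {ℓ : ℕ} (h : D.Regular ℓ) (b : ℕ → ℝ) {j : ℕ}
    (hj : j < ℓ) :
    ∃ κ : ℝ → ℝ, IsClassKInf κ ∧ HasFiniteSlopeAtZero κ ∧
      ∀ y r, |y| ≤ r → |y| + |D.θ b j y| ≤ κ r := by
  let a : ℝ → ℝ := fun y => (D.cBar j + 1 / 4 * b j ^ 2 + D.m j y + D.ψ j y) / b j
  have hm := (h.contDiff_m j hj).continuous
  have hψ := (h.contDiff_ψ j hj).continuous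
  have ha : Continuous a := by fun_prop
  have hθ : ∀ y, |D.θ b j y| = |a y| * |y| := by
    intro y
    rw [h.θ_eq b hj, ← abs_mul, ← abs_neg (a y * y)]
    congr 1
    simp only [a]
    ring
  obtain ⟨F, hFc, hFm, hF, -⟩ := exists_continuous_monotone_envelope
    (h := fun s => max |a s| |a (-s)|) (by fun_prop)
  have haF : ∀ y, |a y| ≤ F |y| := by
    intro y
    refine le_trans ?_ (hF |y| |y| (abs_nonneg y) le_rfl)
    rcases abs_choice y with hy | hy <;> rw [hy]
    · exact le_max_left _ _
    · rw [neg_neg]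
      exact le_max_right _ _
  have hF0 : ∀ s, 0 ≤ s → 0 ≤ F s := fun s hs =>
    (abs_nonneg (a s)).trans ((le_max_left _ _).trans (hF s s hs le_rfl))
  have hid : IsClassK fun s : ℝ => s := IsClassKInf.id.1
  refine ⟨fun s => s + F s * s, ?_, ?_, ?_⟩
  · refine ⟨⟨hid.1.add (hFc.mul hid.1), ?_, by simp⟩, ?_⟩
    · intro s hs t ht hst
      exact add_lt_add_of_lt_of_le hst (mul_le_mul (hFm hs ht hst.le) hst.le hs (hF0 t ht))
    · refine tendsto_atTop_mono' _ ?_ tendsto_id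
      filter_upwards [eventually_ge_atTop 0] with s hs
      exact le_add_of_nonneg_right (mul_nonneg (hF0 s hs) hs)
  · refine HasFiniteSlopeAtZero.id.add ⟨F 0, ?_⟩
    refine ((hFc 0 (mem_Ici.2 le_rfl)).mono_left (nhdsWithin_mono _ Ioi_subset_Ici_self)).congr' ?_
    filter_upwards [self_mem_nhdsWithin] with s hs
    exact (mul_div_cancel_right₀ _ (ne_of_gt hs)).symm
  · intro y r hyr
    have hr := (abs_nonneg y).trans hyr
    rw [hθ]
    exact add_le_add hyr (mul_le_mul ((haF y).trans (hFm (abs_nonneg y) hr hyr)) hyr (abs_nonneg y)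
      (hF0 r hr))

/-- The inverse coordinate change is bounded by a class `K∞` function with finite slope at zero. -/
theorem Design.Regular.exists_xHead_bound {D : Design} {ℓ : ℕ} (h : D.Regular ℓ) (b : ℕ → ℝ) :
    ∀ j, j < ℓ → ∃ κ : ℝ → ℝ, IsClassKInf κ ∧ HasFiniteSlopeAtZero κ ∧
      ∀ x : ℕ → ℝ, ‖xHead (j + 1) x‖ ≤ κ ‖xHead (j + 1) (xBar (D.θ b) x)‖
  | 0, _ => by
    refine ⟨fun s => s, IsClassKInf.id, HasFiniteSlopeAtZero.id, fun x => ?_⟩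
    rw [norm_xHead_one, norm_xHead_one]
    simp [xBar]
  | j + 1, hj => by
    obtain ⟨κ, hκ, hκs, hx⟩ := h.exists_xHead_bound b j (by omega)
    obtain ⟨κ', hκ', hκs', hθ⟩ := h.exists_θ_bound b (j := j) (by omega)
    refine ⟨fun s => κ s + (κ' s + s), hκ.add (hκ'.add IsClassKInf.id.1).1,
      hκs.add (hκs'.add HasFiniteSlopeAtZero.id), fun x => ?_⟩
    have h1 := norm_xHead_succ_sq (j + 1) x
    set y := xBar (D.θ b) x with hy
    set r := ‖xHead (j + 1 + 1) y‖
    have h4 : ‖xHead (j + 1) y‖ ≤ r := norm_xHead_le_succ (j + 1) y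
    have h5 : |y (j + 1)| ≤ r := abs_le_norm_xHead_succ (j + 1) y
    have h6 : |y j| ≤ r := (abs_le_norm_xHead_succ j y).trans h4
    have h7 : |x (j + 1)| ≤ κ' r + r := by
      have h8 : x (j + 1) = y (j + 1) + D.θ b j (y j) := by simp [hy, xBar]
      rw [h8]
      have h9 := abs_add_le (y (j + 1)) (D.θ b j (y j))
      linarith [hθ _ _ h6, abs_nonneg (y j)]
    have h8 := (hx x).trans (hκ.1.mono (norm_nonneg _) h4)
    have h9 := mul_nonneg (norm_nonneg (xHead (j + 1) x)) (abs_nonneg (x (j + 1)))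
    have h10 : ‖xHead (j + 1 + 1) x‖ ≤ ‖xHead (j + 1) x‖ + |x (j + 1)| :=
      le_of_sq_le_sq (by nlinarith) (by positivity)
    linarith

theorem continuousOn_of_continuousOn_xBar {θ : ℕ → ℝ → ℝ} {k : ℕ}
    (hθ : ∀ i, i < k → Continuous (θ i)) {x : ℝ → ℕ → ℝ} {s : Set ℝ}
    (h : ContinuousOn (fun t => xHead k (xBar θ (x t))) s) :
    ContinuousOn (fun t => xHead k (x t)) s := by
  have hy : ∀ i, i < k → ContinuousOn (fun t => xBar θ (x t) i) s := by
    intro i hi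
    have := (PiLp.continuous_apply 2 (fun _ : Fin k => ℝ) ⟨i, hi⟩).comp_continuousOn h
    exact this
  refine continuousOn_xHead fun i hi => ?_
  cases i with
  | zero => exact hy 0 hi
  | succ i =>
    refine ((hy (i + 1) hi).add ((hθ i (by omega)).comp_continuousOn (hy i (by omega)))).congr ?_
    intro t _
    simp [xBar]

theorem LTSystem.exists_isBarGain {P : LTSystem} {D : Design} (hreg : D.Regular P.ℓ)
    (hISS : P.ISSAssumption D) {j : ℕ} (hj : j < P.ℓ) : ∃ γ : ℝ → ℝ, P.IsBarGain D j γ := by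
  obtain ⟨κ, hκ, hκs, hxκ⟩ := hreg.exists_xHead_bound P.b j hj
  obtain ⟨hγz, hγx, -, hγxs, β, hβ, hest⟩ := hISS j hj
  refine ⟨fun s => D.γzx j (κ s), hγx.comp hκ, hγxs.comp hκs hκ.1, β, hβ, ?_⟩
  intro w hw t₀ T hT z x hz hx hsol t ht
  obtain ⟨⟨S, hS, hxc⟩, M, hM⟩ := hx
  have hx' : IsPiecewiseContBdd (fun t => xHead (j + 1) (x t)) t₀ T :=
    ⟨⟨S, hS, continuousOn_of_continuousOn_xBar (fun i hi =>
      (hreg.differentiable_θ P.b (by omega)).continuous) hxc⟩, κ M, fun s hs =>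
      (hxκ (x s)).trans (hκ.1.mono (norm_nonneg _) (hM s hs))⟩
  refine (hest w hw t₀ T hT z x hz hx' hsol t ht).trans
    (max_le_max le_rfl (max_le_max le_rfl (hγx.1.mono (supNorm_nonneg _ _ _) ?_)))
  refine supNorm_le ht.1 fun s hs => (hxκ (x s)).trans (hκ.1.mono (norm_nonneg _) ?_)
  exact norm_le_supNorm (d := fun s => xHead (j + 1) (xBar (D.θ P.b) (x s)))
    (fun s hs => hM s ⟨hs.1, hs.2.trans ht.2⟩) hs

/-! ### Class of the recursively defined gains -/

/-- The inequality imposed on `ψ_j` contains `ψ_j > k_j` on `(0, ∞)`, with `2 k_j` for later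
stages. -/
theorem Design.PsiCondition.const_lt {D : Design} {γbar : ℕ → ℝ → ℝ} {j : ℕ}
    (h : D.PsiCondition γbar j) (hk : 0 < D.k j) {s : ℝ} (hs : 0 < s) :
    (if j = 0 then 1 else 2) * D.k j < D.ψ j s := by
  cases j with
  | zero =>
    refine lt_of_le_of_lt ?_ (h s hs)
    rw [if_pos rfl, mul_comm]
    exact mul_le_mul_of_nonneg_left (le_max_right _ _) hk.le
  | succ j =>
    refine lt_of_le_of_lt ?_ (h s hs)
    rw [if_neg j.succ_ne_zero, mul_comm]
    exact mul_le_mul_of_nonneg_left ((le_max_right _ _).trans (le_max_right _ _)) hk.le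

theorem Design.Regular.k_pos {D : Design} {ℓ : ℕ} (h : D.Regular ℓ) {j : ℕ} (hj : j < ℓ) :
    0 < D.k j :=
  (h.exists_dissipation_rate hj).1

/-- `N_j(s) = ρ_j⁻¹(k_j s²)`, the gain from `x̄_{j+1}` to `x̄_j`. -/
noncomputable def Design.inputGain (D : Design) (j : ℕ) (s : ℝ) : ℝ :=
  D.ρInv j (D.k j * s ^ 2)

section

variable {D : Design} {ℓ : ℕ} {γbar : ℕ → ℝ → ℝ} {j : ℕ}

theorem Design.PsiCondition.lt_ρ (h : D.PsiCondition γbar j) (hk : 0 < D.k j) {s : ℝ}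
    (hs : 0 < s) : (if j = 0 then 1 else 2) * D.k j * s ^ 2 < D.ρ j s :=
  mul_lt_mul_of_pos_right (h.const_lt hk hs) (by positivity)

theorem Design.Regular.ρ_classKInf (hreg : D.Regular ℓ) (hj : j < ℓ) (h : D.PsiCondition γbar j) :
    IsClassKInf (D.ρ j) := by
  have hk := hreg.k_pos hj
  refine ⟨hreg.ρ_classK j hj, tendsto_atTop_mono' _ ?_ (IsClassKInf.const_mul_sq hk).2⟩
  filter_upwards [eventually_gt_atTop 0] with s hs
  refine le_trans ?_ (h.lt_ρ hk hs).le
  have : D.k j * 1 ≤ D.k j * (if j = 0 then 1 else 2) :=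
    mul_le_mul_of_nonneg_left (by split_ifs <;> norm_num) hk.le
  rw [mul_comm _ (D.k j)]
  exact mul_le_mul_of_nonneg_right (by linarith) (sq_nonneg s)

theorem Design.Regular.inputGain_classKInf (hreg : D.Regular ℓ) (hj : j < ℓ)
    (h : D.PsiCondition γbar j) : IsClassKInf (D.inputGain j) :=
  (hreg.ρ_classKInf hj h).invFunOn.comp (IsClassKInf.const_mul_sq (hreg.k_pos hj))

theorem Design.Regular.ρ_inputGain (hreg : D.Regular ℓ) (hj : j < ℓ)
    (h : D.PsiCondition γbar j) (s : ℝ) : D.ρ j (D.inputGain j s) = D.k j * s ^ 2 :=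
  (hreg.ρ_classKInf hj h).apply_invFunOn (mul_nonneg (hreg.k_pos hj).le (sq_nonneg s))

theorem Design.Regular.inputGain_slope (hreg : D.Regular ℓ) (hj : j < ℓ)
    (h : D.PsiCondition γbar j) : HasFiniteSlopeAtZero (D.inputGain j) := by
  have hψ := (hreg.contDiff_ψ j hj).continuous.continuousAt (x := 0)
  have hk := hreg.k_pos hj
  refine HasFiniteSlopeAtZero.of_mul_sq_eq (ψ := D.ψ j) (k := D.k j)
    (hreg.inputGain_classKInf hj h).1 hψ ?_ fun s _ => hreg.ρ_inputGain hj h s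
  refine hk.trans_le (ge_of_tendsto (hψ.tendsto.mono_left (nhdsWithin_le_nhds (s := Ioi 0))) ?_)
  filter_upwards [self_mem_nhdsWithin] with s hs
  refine le_trans ?_ (h.const_lt hk hs).le
  exact le_mul_of_one_le_left hk.le (by split_ifs <;> norm_num)

theorem Design.Regular.inputGain_lt (hreg : D.Regular ℓ) (hj : j < ℓ)
    (h : D.PsiCondition γbar j) {s : ℝ} (hs : 0 < s) :
    (if j = 0 then 1 else √2) * D.inputGain j s < s := by
  have hk := hreg.k_pos hj
  have hρ := hreg.ρ_classKInf hj h
  have hk0 : 0 ≤ D.k j * s ^ 2 := by positivity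
  split_ifs with h0
  · rw [one_mul]
    refine (hρ.invFunOn_lt_iff hs.le hk0).2 ?_
    have := h.lt_ρ hk hs
    rw [if_pos h0, one_mul] at this
    exact this
  · have h2 : (0 : ℝ) < √2 := by positivity
    have hs2 : 0 < s / √2 := by positivity
    have : D.inputGain j s < s / √2 := by
      refine (hρ.invFunOn_lt_iff hs2.le hk0).2 ?_
      have := h.lt_ρ hk hs2
      rw [if_neg h0, div_pow, Real.sq_sqrt zero_le_two] at this
      linarith
    rw [lt_div_iff₀ h2] at this
    linarith

end

theorem Design.gainX_eq (D : Design) (j : ℕ) (s : ℝ) :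
    D.gainX j s = (if j = 0 then 1 else 2) * D.inputGain j s := by
  cases j <;> simp [Design.gainX, Design.inputGain]

theorem Design.Regular.gainX_class {D : Design} {ℓ : ℕ} {γbar : ℕ → ℝ → ℝ} (hreg : D.Regular ℓ)
    {j : ℕ} (hj : j < ℓ) (h : D.PsiCondition γbar j) :
    IsClassKInf (D.gainX j) ∧ HasFiniteSlopeAtZero (D.gainX j) := by
  rw [funext (D.gainX_eq j)]
  exact ⟨(hreg.inputGain_classKInf hj h).const_mul (by split_ifs <;> norm_num),
    (hreg.inputGain_slope hj h).const_mul _⟩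

theorem LTSystem.gainZX_class {P : LTSystem} {D : Design} (hreg : D.Regular P.ℓ)
    (hISS : P.ISSAssumption D) {γbar : ℕ → ℝ → ℝ}
    (hγ : ∀ j, 0 < j → j < P.ℓ → P.IsBarGain D j (γbar j))
    (hψ : ∀ j, j < P.ℓ → D.PsiCondition γbar j) :
    ∀ j, j < P.ℓ → IsClassKInf (D.gainZX γbar j) ∧ HasFiniteSlopeAtZero (D.gainZX γbar j)
  | 0, hj => ⟨(hISS 0 hj).2.1, (hISS 0 hj).2.2.2.1⟩
  | j + 1, hj => by
    have hj' : j < P.ℓ := by omega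
    obtain ⟨h1, h2⟩ := P.gainZX_class hreg hISS hγ hψ j hj'
    obtain ⟨h3, h4⟩ := hreg.gainX_class hj' (hψ j hj')
    obtain ⟨h5, -, h6, -⟩ := hISS (j + 1) hj
    obtain ⟨h7, h8, -⟩ := hγ (j + 1) (Nat.succ_pos j) hj
    have h9 := h1.comp h3
    have h10 := h2.comp h4 h3.1
    exact ⟨(h7.sup (h9.sup (h5.comp h9).1).1).const_mul two_pos,
      (h8.sup (h10.sup (h6.comp h10 h9.1))).const_mul 2⟩

theorem LTSystem.gainZ_class {P : LTSystem} {D : Design} (hreg : D.Regular P.ℓ)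
    (hISS : P.ISSAssumption D) {γbar : ℕ → ℝ → ℝ}
    (hγ : ∀ j, 0 < j → j < P.ℓ → P.IsBarGain D j (γbar j))
    (hψ : ∀ j, j < P.ℓ → D.PsiCondition γbar j) {j : ℕ} (hj : j < P.ℓ) :
    IsClassKInf (D.gainZ γbar j) ∧ HasFiniteSlopeAtZero (D.gainZ γbar j) := by
  obtain ⟨h1, h2⟩ := P.gainZX_class hreg hISS hγ hψ j hj
  obtain ⟨h3, h4⟩ := hreg.gainX_class hj (hψ j hj)
  exact ⟨h1.comp h3, h2.comp h4 h3.1⟩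

/-! ### The recursion -/

/-- A trajectory of the `(ẑ_j, x̄̂_j)`-dynamics on `[t₀, T]`, with its parameter value and with a
piecewise continuous bounded external input `x̄_{j+1}`. -/
structure LTSystem.StageTrajectory (P : LTSystem) (θ : ℕ → ℝ → ℝ) (j : ℕ) where
  w : EuclideanSpace ℝ (Fin P.p)
  t₀ : ℝ
  T : ℝ
  z : ℝ → P.ZState
  x : ℝ → ℕ → ℝ
  mem : w ∈ P.W
  input : IsPiecewiseContBdd (fun t => xBar θ (x t) (j + 1)) t₀ T
  solves : ∀ i, i ≤ j → P.SolvesZ w i z x t₀ T ∧ P.SolvesX w i z x t₀ T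

namespace LTSystem.StageTrajectory

variable {P : LTSystem} {θ : ℕ → ℝ → ℝ} {j : ℕ}

/-- `‖ẑ‖` for the first `k` blocks. -/
noncomputable def zNorm (k : ℕ) (τ : P.StageTrajectory θ j) (t : ℝ) : ℝ := ‖zHead k (τ.z t)‖

/-- `‖x̄̂‖` for the first `k` coordinates. -/
noncomputable def xNorm (k : ℕ) (τ : P.StageTrajectory θ j) (t : ℝ) : ℝ :=
  ‖xHead k (xBar θ (τ.x t))‖

/-- `|x̄_k|`. -/
def xAbs (k : ℕ) (τ : P.StageTrajectory θ j) (t : ℝ) : ℝ := |xBar θ (τ.x t) k|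

/-- `‖col(ẑ, x̄̂)‖` for the first `k` blocks and coordinates. -/
noncomputable def stateNorm (k : ℕ) (τ : P.StageTrajectory θ j) (t : ℝ) : ℝ :=
  ‖WithLp.toLp 2 (zHead k (τ.z t), xHead k (xBar θ (τ.x t)))‖

variable (k : ℕ) (τ : P.StageTrajectory θ j) (t : ℝ)

theorem stateNorm_sq : τ.stateNorm k t ^ 2 = τ.zNorm k t ^ 2 + τ.xNorm k t ^ 2 := by
  simp [stateNorm, zNorm, xNorm, WithLp.prod_norm_sq_eq_of_L2]

theorem zNorm_nonneg : 0 ≤ τ.zNorm k t := norm_nonneg _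

theorem xNorm_nonneg : 0 ≤ τ.xNorm k t := norm_nonneg _

theorem xAbs_nonneg : 0 ≤ τ.xAbs k t := abs_nonneg _

theorem stateNorm_nonneg : 0 ≤ τ.stateNorm k t := norm_nonneg _

theorem zNorm_le_stateNorm : τ.zNorm k t ≤ τ.stateNorm k t :=
  le_of_sq_le_sq (by rw [stateNorm_sq]; linarith [sq_nonneg (τ.xNorm k t)])
    (τ.stateNorm_nonneg k t)

theorem xNorm_le_stateNorm : τ.xNorm k t ≤ τ.stateNorm k t :=
  le_of_sq_le_sq (by rw [stateNorm_sq]; linarith [sq_nonneg (τ.zNorm k t)])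
    (τ.stateNorm_nonneg k t)

theorem xAbs_le_stateNorm : τ.xAbs k t ≤ τ.stateNorm (k + 1) t :=
  (abs_le_norm_xHead_succ k _).trans (τ.xNorm_le_stateNorm (k + 1) t)

theorem norm_le_stateNorm : ‖τ.z t k‖ ≤ τ.stateNorm (k + 1) t :=
  (norm_le_norm_zHead_succ k _).trans (τ.zNorm_le_stateNorm (k + 1) t)

theorem stateNorm_le_succ : τ.stateNorm k t ≤ τ.stateNorm (k + 1) t := by
  refine le_of_sq_le_sq ?_ (τ.stateNorm_nonneg (k + 1) t)
  rw [stateNorm_sq, stateNorm_sq]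
  exact add_le_add (pow_le_pow_left₀ (norm_nonneg _) (norm_zHead_le_succ k _) 2)
    (pow_le_pow_left₀ (norm_nonneg _) (norm_xHead_le_succ k _) 2)

theorem stateNorm_succ_le :
    τ.stateNorm (k + 1) t ≤ τ.zNorm (k + 1) t + τ.xNorm k t + τ.xAbs k t := by
  have h1 := τ.stateNorm_sq (k + 1) t
  have h2 : τ.xNorm (k + 1) t ^ 2 = τ.xNorm k t ^ 2 + τ.xAbs k t ^ 2 := norm_xHead_succ_sq k _
  have h3 := τ.zNorm_nonneg (k + 1) t
  have h4 := τ.xNorm_nonneg k t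
  have h5 := τ.xAbs_nonneg k t
  have h6 := mul_nonneg h3 h4
  have h7 := mul_nonneg h3 h5
  have h8 := mul_nonneg h4 h5
  exact le_of_sq_le_sq (by nlinarith) (by positivity)

theorem xNorm_succ_le : τ.xNorm (k + 1) t ≤ √2 * max (τ.xNorm k t) (τ.xAbs k t) :=
  le_sqrt_two_mul_max (τ.xNorm_nonneg k t) (τ.xAbs_nonneg k t) (norm_xHead_succ_sq k _)

theorem zNorm_succ_le : τ.zNorm (k + 1) t ≤ √2 * max (τ.zNorm k t) ‖τ.z t k‖ :=
  le_sqrt_two_mul_max (τ.zNorm_nonneg k t) (norm_nonneg _) (norm_zHead_succ_sq k _)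

theorem continuousOn_z {i : ℕ} (hi : i ≤ j) : ContinuousOn (fun t => τ.z t i) (Icc τ.t₀ τ.T) :=
  (τ.solves i hi).1.1

theorem continuousOn_xBar (hθ : ∀ i, i < j → Differentiable ℝ (θ i)) {i : ℕ} (hi : i ≤ j) :
    ContinuousOn (fun t => xBar θ (τ.x t) i) (Icc τ.t₀ τ.T) :=
  (P.isSolution_xBar i (fun i' hi' => hθ i' (by omega))
    fun i' hi' => (τ.solves i' (by omega)).2).1

end LTSystem.StageTrajectory

/-- The estimates of a stage, applied to the trajectories of the next stage. -/
theorem LTSystem.StageISS.hasKLEstimate {P : LTSystem} {θ : ℕ → ℝ → ℝ} {j : ℕ} {gZ gX : ℝ → ℝ}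
    (h : P.StageISS θ j gZ gX) (hθ : ∀ i, i < j + 1 → Differentiable ℝ (θ i)) (hgZ : IsClassK gZ)
    (hgX : IsClassK gX) :
    HasKLEstimate (I := P.StageTrajectory θ (j + 1)) (fun τ => τ.t₀) (fun τ => τ.T)
        (fun τ => τ.stateNorm (j + 1)) (fun τ => τ.zNorm (j + 1)) (fun τ => τ.xAbs (j + 1)) gZ ∧
      HasKLEstimate (I := P.StageTrajectory θ (j + 1)) (fun τ => τ.t₀) (fun τ => τ.T)
        (fun τ => τ.stateNorm (j + 1)) (fun τ => τ.xNorm (j + 1)) (fun τ => τ.xAbs (j + 1)) gX := by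
  obtain ⟨βZ, βX, hβZ, hβX, hest⟩ := h
  have key : ∀ (τ : P.StageTrajectory θ (j + 1)) t₁ t B,
      BoundedOnSegment (fun τ : P.StageTrajectory θ (j + 1) => τ.t₀) (fun τ => τ.T)
        (fun τ => τ.xAbs (j + 1)) τ t₁ t B →
      τ.zNorm (j + 1) t ≤ max (βZ (τ.stateNorm (j + 1) t₁) (t - t₁)) (gZ B) ∧
      τ.xNorm (j + 1) t ≤ max (βX (τ.stateNorm (j + 1) t₁) (t - t₁)) (gX B) := by
    intro τ t₁ t B hs
    obtain ⟨h1, h2⟩ := hest τ.w τ.mem t₁ t hs.le τ.z τ.x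
      ((τ.continuousOn_xBar hθ le_rfl).mono (Icc_subset_Icc hs.lo_le hs.le_hi)).isPiecewiseContBdd
      (fun i hi => ⟨(τ.solves i (by omega)).1.mono hs.lo_le hs.le_hi,
        (τ.solves i (by omega)).2.mono hs.lo_le hs.le_hi⟩) t ⟨hs.le, le_rfl⟩
    have h3 : supNorm (fun s => xBar θ (τ.x s) (j + 1)) t₁ t ≤ B := supNorm_le hs.le hs.bound
    exact ⟨h1.trans (max_le_max le_rfl (hgZ.mono (supNorm_nonneg _ _ _) h3)),
      h2.trans (max_le_max le_rfl (hgX.mono (supNorm_nonneg _ _ _) h3))⟩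
  exact ⟨⟨βZ, hβZ, fun τ t₁ t B hs => (key τ t₁ t B hs).1⟩,
    ⟨βX, hβX, fun τ t₁ t B hs => (key τ t₁ t B hs).2⟩⟩

theorem LTSystem.StageISS.of_hasKLEstimate {P : LTSystem} {θ : ℕ → ℝ → ℝ} {j : ℕ}
    {gZ gX : ℝ → ℝ}
    (hZ : HasKLEstimate (I := P.StageTrajectory θ j) (fun τ => τ.t₀) (fun τ => τ.T)
      (fun τ => τ.stateNorm (j + 1)) (fun τ => τ.zNorm (j + 1)) (fun τ => τ.xAbs (j + 1)) gZ)
    (hX : HasKLEstimate (I := P.StageTrajectory θ j) (fun τ => τ.t₀) (fun τ => τ.T)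
      (fun τ => τ.stateNorm (j + 1)) (fun τ => τ.xNorm (j + 1)) (fun τ => τ.xAbs (j + 1)) gX) :
    P.StageISS θ j gZ gX := by
  obtain ⟨βZ, hβZ, hZ⟩ := hZ
  obtain ⟨βX, hβX, hX⟩ := hX
  refine ⟨βZ, βX, hβZ, hβX, fun w hw t₀ T _ z x hu hsol t ht => ?_⟩
  let τ : P.StageTrajectory θ j := ⟨w, t₀, T, z, x, hw, hu, hsol⟩
  obtain ⟨M, hM⟩ := hu.2
  have hs : BoundedOnSegment (fun τ : P.StageTrajectory θ j => τ.t₀) (fun τ => τ.T)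
      (fun τ => τ.xAbs (j + 1)) τ t₀ t (supNorm (fun s => xBar θ (x s) (j + 1)) t₀ t) :=
    ⟨le_refl t₀, ht.1, ht.2, supNorm_nonneg _ _ _, fun s hs =>
      norm_le_supNorm (d := fun s => xBar θ (x s) (j + 1))
        (fun s hs => hM s ⟨hs.1, hs.2.trans ht.2⟩) hs⟩
  exact ⟨hZ τ t₀ t _ hs, hX τ t₀ t _ hs⟩

/-- The ISS estimate of the first `z`-subsystem. -/
theorem LTSystem.ISSAssumption.hasKLEstimate_zero {P : LTSystem} {D : Design}
    (hISS : P.ISSAssumption D) (h0 : 0 < P.ℓ) (θ : ℕ → ℝ → ℝ) :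
    HasKLEstimate (I := P.StageTrajectory θ 0) (fun τ => τ.t₀) (fun τ => τ.T)
      (fun τ => τ.stateNorm 1) (fun τ => τ.zNorm 1) (fun τ => τ.xAbs 0) (D.γzx 0) := by
  obtain ⟨hγz, hγx, -, -, β, hβ, hest⟩ := hISS 0 h0
  refine ⟨β, hβ, fun τ t₁ t B hs => ?_⟩
  have hsub := Icc_subset_Icc hs.lo_le hs.le_hi
  have hx : ContinuousOn (fun t => xHead 1 (τ.x t)) (Icc t₁ t) :=
    continuousOn_xHead fun i hi => by
      obtain rfl : i = 0 := by omega
      exact ((τ.solves 0 le_rfl).2.1).mono hsub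
  have h := hest τ.w τ.mem t₁ t hs.le τ.z τ.x
    (ContinuousOn.isPiecewiseContBdd (continuousOn_zHead fun i hi => absurd hi (Nat.not_lt_zero i)))
    hx.isPiecewiseContBdd ((τ.solves 0 le_rfl).1.mono hs.lo_le hs.le_hi) t ⟨hs.le, le_rfl⟩
  have hz0 : supNorm (fun s => zHead 0 (τ.z s)) t₁ t ≤ 0 :=
    supNorm_le hs.le fun s _ => (norm_zHead_zero _).le
  have hx0 : supNorm (fun s => xHead 1 (τ.x s)) t₁ t ≤ B :=
    supNorm_le hs.le fun s hs' => (norm_xHead_one _).le.trans (hs.bound s hs')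
  have h1 : τ.zNorm 1 t = ‖τ.z t 0‖ := norm_zHead_one _
  refine (h1.le.trans h).trans (max_le_max (hβ.mono (norm_nonneg _) (τ.norm_le_stateNorm 0 t₁)
    (sub_nonneg.2 hs.le) le_rfl) (max_le ?_ (hγx.1.mono (supNorm_nonneg _ _ _) hx0)))
  refine (hγz.1.mono (supNorm_nonneg _ _ _) hz0).trans ?_
  rw [hγz.1.2.2]
  exact hγx.1.nonneg hs.nonneg

/-- The ISS estimate of a later `z`-subsystem with respect to the transformed input. -/
theorem LTSystem.ZSubsystemISSBar.exists_estimate {P : LTSystem} {θ : ℕ → ℝ → ℝ} {j : ℕ}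
    {γz γx : ℝ → ℝ} (h : P.ZSubsystemISSBar θ j γz γx)
    (hθ : ∀ i, i < j → Differentiable ℝ (θ i)) (hγz : IsClassK γz) (hγx : IsClassK γx) :
    ∃ β, IsClassKL β ∧ ∀ (τ : P.StageTrajectory θ j) t₁ t B₁ B₂,
      BoundedOnSegment (fun τ : P.StageTrajectory θ j => τ.t₀) (fun τ => τ.T)
        (fun τ => τ.zNorm j) τ t₁ t B₁ →
      BoundedOnSegment (fun τ : P.StageTrajectory θ j => τ.t₀) (fun τ => τ.T)
        (fun τ => τ.xNorm (j + 1)) τ t₁ t B₂ →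
      ‖τ.z t j‖ ≤ max (β ‖τ.z t₁ j‖ (t - t₁)) (max (γz B₁) (γx B₂)) := by
  obtain ⟨β, hβ, hest⟩ := h
  refine ⟨β, hβ, fun τ t₁ t B₁ B₂ h₁ h₂ => ?_⟩
  have hsub := Icc_subset_Icc h₁.lo_le h₁.le_hi
  have h := hest τ.w τ.mem t₁ t h₁.le τ.z τ.x
    (ContinuousOn.isPiecewiseContBdd (continuousOn_zHead fun i hi =>
      (τ.continuousOn_z hi.le).mono hsub))
    (ContinuousOn.isPiecewiseContBdd (continuousOn_xHead (x := fun t => xBar θ (τ.x t))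
      fun i hi => (τ.continuousOn_xBar hθ (by omega)).mono hsub))
    ((τ.solves j le_rfl).1.mono h₁.lo_le h₁.le_hi) t ⟨h₁.le, le_rfl⟩
  exact h.trans (max_le_max le_rfl (max_le_max
    (hγz.mono (supNorm_nonneg _ _ _) (supNorm_le h₁.le h₁.bound))
    (hγx.mono (supNorm_nonneg _ _ _) (supNorm_le h₂.le h₂.bound))))

/-- One small-gain step: the estimates of `ẑ_j` and of the previous `x̄`-coordinates in terms of
`x̄_j` give the estimates of the stage, once the condition on `ψ_j` closes the loop. Here `Γ` is the
gain from `|x̄_j|` to `ẑ_j`, and `κ` accounts for the norm of the stack `(x̄̂_{j-1}, x̄_j)`. The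
function `μ` is `m̄_j`, or zero for the first stage, where `x̄̂_{j-1}` is empty and the condition on
`ψ_j` does not involve `m̄_j`. -/
theorem LTSystem.stageISS_of_estimates {P : LTSystem} {D : Design} (hreg : D.Regular P.ℓ)
    (hdrift : P.DriftBound D) {γbar : ℕ → ℝ → ℝ} {j : ℕ} (hj : j < P.ℓ)
    (hψ : D.PsiCondition γbar j) {Γ μ : ℝ → ℝ} {κ : ℝ} (hκ : 0 < κ) (hΓ : IsClassKInf Γ)
    (hμc : ContinuousOn μ (Ici 0)) (hμ0 : μ 0 = 0)
    (hιΓ : ∀ s, 0 < s → D.k j * D.ιBar j (Γ s) < D.ρ j s)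
    (hμρ : ∀ s, 0 < s → D.k j * μ s < D.ρ j s)
    (hμ : ∀ y : ℕ → ℝ, D.mBar j ‖xHead j y‖ = μ ‖xHead j y‖)
    (hκX : ∀ (τ : P.StageTrajectory (D.θ P.b) j) t,
      τ.xNorm (j + 1) t ≤ κ * max (τ.xNorm j t) (τ.xAbs j t))
    (hZ : HasKLEstimate (I := P.StageTrajectory (D.θ P.b) j) (fun τ => τ.t₀) (fun τ => τ.T)
      (fun τ => τ.stateNorm (j + 1)) (fun τ => τ.zNorm (j + 1)) (fun τ => τ.xAbs j) Γ)
    (hX : HasKLEstimate (I := P.StageTrajectory (D.θ P.b) j) (fun τ => τ.t₀) (fun τ => τ.T)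
      (fun τ => τ.stateNorm (j + 1)) (fun τ => τ.xNorm j) (fun τ => τ.xAbs j) (fun s => s)) :
    P.StageISS (D.θ P.b) j (fun s => Γ (D.inputGain j s)) (fun s => κ * D.inputGain j s) := by
  have hρ := hreg.ρ_classKInf hj hψ
  have hN := hreg.inputGain_classKInf hj hψ
  have hk := hreg.k_pos hj
  have hιc : ContinuousOn (D.ιBar j) (Ici 0) := by
    have := (hreg.contDiff_ι j hj).continuousOn
    unfold Design.ιBar
    fun_prop
  obtain ⟨χ, hχc, hχm, hχ, hdom⟩ :=
    exists_loop_gain hρ hΓ hιc hμc (D.ιBar_zero j) hμ0 hιΓ hμρ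
  obtain ⟨c, hc, hdecay⟩ := P.exists_decay hreg hdrift hj
  have hsettle := Settles.small_gain (I := P.StageTrajectory (D.θ P.b) j) (lo := fun τ => τ.t₀)
    (hi := fun τ => τ.T) (σ := fun τ => τ.stateNorm (j + 1)) (X := fun τ => τ.xNorm j)
    (Y := fun τ => τ.zNorm (j + 1)) (ξ := fun τ => τ.xAbs j) (u := fun τ => τ.xAbs (j + 1))
    (Γ := Γ) (χ := χ) (N := D.inputGain j) (C := fun m => c * D.ρ j m)
    (fun τ t => τ.xAbs_nonneg j t) (fun τ t => τ.xAbs_le_stateNorm j t)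
    (fun τ t => τ.stateNorm_succ_le j t)
    (fun τ => (τ.continuousOn_xBar (fun i hi => hreg.differentiable_θ P.b (hi.trans hj))
      le_rfl).abs)
    hΓ hN hχc hχm hχ (hρ.1.const_mul hc).monotoneOn (fun s hs => mul_pos hc (hρ.1.pos hs)) hZ hX
    (by
      intro τ t₁ t B b m hs hb hXY hm hχb hNB
      refine hdecay τ.w τ.mem τ.z τ.x t₁ t m hs.le hm
        (fun i hi => (τ.solves i hi).2.mono hs.lo_le hs.le_hi) fun s hs' => ?_
      obtain ⟨h1, h2⟩ := hdom b m hb hm.le hχb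
      refine ⟨h1 _ (norm_nonneg _) (hXY s hs').2, ?_, ?_⟩
      · rw [hμ]
        exact h2 _ (norm_nonneg _) (hXY s hs').1
      · have h3 := hρ.1.mono (hN.1.nonneg hs.nonneg) hNB
        rw [hreg.ρ_inputGain hj hψ] at h3
        exact (mul_le_mul_of_nonneg_left
          (pow_le_pow_left₀ (abs_nonneg _) (hs.bound s hs') 2) hk.le).trans h3)
  refine LTSystem.StageISS.of_hasKLEstimate
    (hsettle.hasKLEstimate (fun τ t => τ.stateNorm_nonneg _ t) hN hΓ fun τ t b _ h => h.2.2)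
    (hsettle.hasKLEstimate (φ := fun s => κ * s) (fun τ t => τ.stateNorm_nonneg _ t) hN
      (IsClassKInf.id.const_mul hκ) fun τ t b _ h => ?_)
  exact (hκX τ t).trans (mul_le_mul_of_nonneg_left (max_le h.2.1 h.1) hκ.le)

/-- The estimates of all stages, by induction. The gain from `x̄_{j+1}` to `x̄̂_j` is `N_0` for the
first stage and `√2 N_j` for the later ones; the sharp constant `√2` is needed for this gain to be
below the identity. -/
theorem LTSystem.stageISS {P : LTSystem} {D : Design} (hreg : D.Regular P.ℓ)
    (hISS : P.ISSAssumption D) (hdrift : P.DriftBound D) {γbar : ℕ → ℝ → ℝ}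
    (hγ : ∀ j, 0 < j → j < P.ℓ → P.IsBarGain D j (γbar j))
    (hψ : ∀ j, j < P.ℓ → D.PsiCondition γbar j) :
    ∀ j, j < P.ℓ → P.StageISS (D.θ P.b) j (D.gainZ γbar j)
      (fun s => (if j = 0 then 1 else √2) * D.inputGain j s)
  | 0, hj => by
    have hk := hreg.k_pos hj
    have hZ := hISS.hasKLEstimate_zero hj (D.θ P.b)
    have hX : HasKLEstimate (I := P.StageTrajectory (D.θ P.b) 0) (fun τ => τ.t₀) (fun τ => τ.T)
        (fun τ => τ.stateNorm 1) (fun τ => τ.xNorm 0) (fun τ => τ.xAbs 0) (fun s => s) := by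
      obtain ⟨β, hβ, -⟩ := hZ
      exact ⟨β, hβ, fun τ t₁ t B hs => (norm_xHead_zero _).le.trans
        (hs.nonneg.trans (le_max_right _ _))⟩
    refine P.stageISS_of_estimates hreg hdrift hj (hψ 0 hj) (Γ := D.γzx 0) (μ := fun _ => 0)
      (κ := 1) one_pos (hISS 0 hj).2.1 continuousOn_const rfl ?_ ?_ ?_ ?_ hZ hX
    · intro s hs
      have h := (mul_le_mul_of_nonneg_left (le_max_left _ _) hk.le).trans_lt (hψ 0 hj s hs)
      rwa [← mul_div_assoc, div_lt_iff₀ (by positivity)] at h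
    · intro s hs
      simpa using (hreg.ρ_classK 0 hj).pos hs
    · intro y
      rw [norm_xHead_zero, D.mBar_zero]
    · intro τ t
      rw [one_mul]
      exact (norm_xHead_one _).le.trans (le_max_right _ _)
  | j + 1, hj => by
    have hj' : j < P.ℓ := by omega
    have hk := hreg.k_pos hj
    have hθ : ∀ i, i < j + 1 → Differentiable ℝ (D.θ P.b i) := fun i hi =>
      hreg.differentiable_θ P.b (hi.trans hj)
    have hprev := LTSystem.stageISS hreg hISS hdrift hγ hψ j hj'
    have hg := (P.gainZ_class hreg hISS hγ hψ hj').1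
    have hN := hreg.inputGain_classKInf hj' (hψ j hj')
    have hgX := hN.const_mul (c := if j = 0 then 1 else √2) (by split_ifs <;> positivity)
    have hgXle : ∀ s, 0 ≤ s → (if j = 0 then 1 else √2) * D.inputGain j s ≤ s := by
      intro s hs
      rcases hs.eq_or_lt with rfl | hs
      · rw [hN.1.2.2, mul_zero]
      · exact (hreg.inputGain_lt hj' (hψ j hj') hs).le
    obtain ⟨hZ₁, hX₁⟩ := hprev.hasKLEstimate hθ hg.1 hgX.1
    obtain ⟨hγzz, -⟩ := hISS (j + 1) hj
    obtain ⟨hγb, -, hbar⟩ := hγ (j + 1) (Nat.succ_pos j) hj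
    have hG := (P.gainZX_class hreg hISS hγ hψ (j + 1) hj).1
    have hΓ : IsClassKInf (fun s => D.gainZX γbar (j + 1) (2 * s)) :=
      hG.comp (IsClassKInf.id.const_mul two_pos)
    have hZ := HasKLEstimate.cascade (I := P.StageTrajectory (D.θ P.b) (j + 1))
      (σ := fun τ => τ.stateNorm (j + 1 + 1)) (Xh := fun τ => τ.xNorm (j + 1 + 1))
      (ζ := fun τ t => ‖τ.z t (j + 1)‖) (Y := fun τ => τ.zNorm (j + 1 + 1))
      (fun τ t => τ.stateNorm_nonneg _ t) (fun τ t => τ.stateNorm_le_succ _ t)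
      (fun τ t => norm_nonneg _) (fun τ t => τ.norm_le_stateNorm _ t)
      (fun τ t => (τ.xNorm_succ_le _ t).trans (mul_le_mul_of_nonneg_right sqrt_two_le_two
        ((τ.xNorm_nonneg _ t).trans (le_max_left _ _))))
      (fun τ t => (τ.zNorm_succ_le _ t).trans (mul_le_mul_of_nonneg_right sqrt_two_le_two
        ((τ.zNorm_nonneg _ t).trans (le_max_left _ _))))
      hgXle hg hγzz hγb hΓ
      (by
        intro b hb
        have h1 := hg.1.mono hb (by linarith : b ≤ 2 * b)
        simp only [Design.gainZX]
        exact mul_le_mul_of_nonneg_left (max_le_max le_rfl (max_le_max h1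
          (hγzz.1.mono (hg.1.nonneg hb) h1))) zero_le_two)
      hX₁ hZ₁ (hbar.exists_estimate hθ hγzz.1 hγb.1)
    have hX := hX₁.mono (fun τ t => τ.stateNorm_nonneg _ t) (fun τ t => τ.stateNorm_le_succ _ t)
      (fun τ t => le_rfl) hgXle
    have hmc : ContinuousOn (D.mBar (j + 1)) (Ici 0) := by
      have := (hreg.contDiff_mt (j + 1) hj).continuousOn
      unfold Design.mBar
      fun_prop
    rw [if_neg j.succ_ne_zero]
    refine P.stageISS_of_estimates hreg hdrift hj (hψ (j + 1) hj) (κ := √2) (by positivity) hΓ hmc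
      (D.mBar_zero _) ?_ ?_ (fun _ => rfl) (fun τ t => τ.xNorm_succ_le _ t) hZ hX
    · intro s hs
      have h := (mul_le_mul_of_nonneg_left ((le_max_left _ _).trans (le_max_right _ _))
        hk.le).trans_lt (hψ (j + 1) hj s hs)
      rwa [← mul_div_assoc, div_lt_iff₀ (by positivity)] at h
    · intro s hs
      have h := (mul_le_mul_of_nonneg_left (le_max_left _ _) hk.le).trans_lt (hψ (j + 1) hj s hs)
      rwa [← mul_div_assoc, div_lt_iff₀ (by positivity)] at h

theorem lemma2 (P : LTSystem) (D : Design)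
    (hreg : D.Regular P.ℓ) (hISS : P.ISSAssumption D) (hdrift : P.DriftBound D) :
    (∀ j, j < P.ℓ → ∃ γ : ℝ → ℝ, P.IsBarGain D j γ) ∧
    ∀ γbar : ℕ → ℝ → ℝ,
      (∀ j, 0 < j → j < P.ℓ → P.IsBarGain D j (γbar j)) →
      (∀ j, j < P.ℓ → D.PsiCondition γbar j) →
      ∀ j, j < P.ℓ →
        IsClassK (D.gainZ γbar j) ∧ HasFiniteSlopeAtZero (D.gainZ γbar j) ∧
        ∃ gX : ℝ → ℝ, IsClassK gX ∧ (∀ s, 0 < s → gX s < s) ∧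
          P.StageISS (D.θ P.b) j (D.gainZ γbar j) gX := by
  refine ⟨fun j hj => P.exists_isBarGain hreg hISS hj, fun γbar hγ hψ j hj => ?_⟩
  obtain ⟨h1, h2⟩ := P.gainZ_class hreg hISS hγ hψ hj
  exact ⟨h1.1, h2, fun s => (if j = 0 then 1 else √2) * D.inputGain j s,
    (hreg.inputGain_classKInf hj (hψ j hj)).1.const_mul (by split_ifs <;> positivity),
    fun s hs => hreg.inputGain_lt hj (hψ j hj) hs,
    P.stageISS hreg hISS hdrift hγ hψ j hj⟩
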